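/- **Setting.** Let $\Gamma$ be a hyperbolic group, $S$ any finite generating set of $\Gamma$, and $C_S(\Gamma)$ the Cayley graph with its word metric $d_S$, on which $\Gamma$ acts by left multiplication. Let $X$ be a proper geodesic Gromov-hyperbolic metric space, and $G=\mathrm{Isom}(X)$ with the compact-open topology. A hyperbolicity constant of a metric space is a $\delta>0$ such that $\langle x,z\rangle_w\ge\min\{\langle x,y\rangle_w,\langle y,z\rangle_w\}-\delta$ for all points $w,x,y,z$, where $\langle x,y\rangle_w=\tfrac12(d(x,w)+d(y,w)-d(x,y))$. Let $R(\Gamma,G)$ be the set of homomorphisms $\Gamma\to G$, topologized as a subset of the product $G^{S}$, and let $X(\Gamma,G)$ be its quotient by conjugation by elements of $G$, with the quotient topology. The group $\mathrm{Out}(\Gamma)=\mathrm{Aut}(\Gamma)/\mathrm{Inn}(\Gamma)$ acts on $X(\Gamma,G)$ by $[\varphi]\cdot[\rho]=[\rho\circ\varphi^{-1}]$. A map $f$ between metric spaces is a $(K,C)$ quasi-isometric embedding if $\frac1K d(y,z)-C\le d(f(y),f(z))\le K d(y,z)+C$ for all $y,z$. For $\gamma\in\Gamma$ of infinite order, let $L_S(\gamma)$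 be the set of bi-infinite geodesics $l=(l_n)_{n\in\mathbb Z}$ of $C_S(\Gamma)$ (so $l_n\in\Gamma$ and $d_S(l_m,l_n)=|m-n|$) connecting the two fixed points of $\gamma$ in the Gromov boundary of $C_S(\Gamma)$. Let $A\subset\Gamma$ satisfy $\varphi(A)=A$ for all $\varphi\in\mathrm{Aut}(\Gamma)$. For $K\ge1$, $C\ge0$, a representation $\rho\in R(\Gamma,G)$ is *$(K,C)$ $A$-stable* if there is $x\in X$ such that, for every $a\in A$ of infinite order and every $l\in L_S(a)$, the map $\mathbb Z\to X$, $n\mapsto\rho(l_n)(x)$, is a $(K,C)$ quasi-isometric embedding; it is *$A$-stable* if it is $(K,C)$ $A$-stable for some $K\ge1$, $C\ge0$. Let $S_A(\Gamma,G)\subset X(\Gamma,G)$ be the set of conjugacy classes of $A$-stable representations. A representation $\rho$ is *quasi-convex* if $\ker\rho$ is finite, $\rho(\Gamma)$ is a discrete subgroup of $G$, and for some $x\in X$ and $\eta>0$ any two points of the orbit $\rho(\Gamma)x$ are joined by a geodesic segment contained in the $\eta$-neighbourhood of $\rho(\Gamma)x$. Let $QC(\Gamma,G)\subset X(\Gamma,G)$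 be the set of conjugacy classes of quasi-convex representations. **Proposition.** 1. The set $S_A(\Gamma,G)$ is open in $X(\Gamma,G)$, is invariant under $\mathrm{Out}(\Gamma)$, and contains $QC(\Gamma,G)$. 2. For all $\delta>0$, $K_0\ge1$ and $C_0\ge0$ there are constants $K\ge1$ and $C\ge0$, depending only on $\delta$, $K_0$ and $C_0$, such that for all $\Gamma$, $S$, $X$, $A$ as above for which $\delta$ is a hyperbolicity constant of $X$, every $(K_0,C_0)$ $A$-stable representation $\rho_0$ has the following property: there is an open neighbourhood $U_0$ of $[\rho_0]$ in $X(\Gamma,G)$ such that every representation $\rho$ with $[\rho]\in U_0$ is $(K,C)$ $A$-stable. -/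

import Mathlib

open Set Topology

universe u v

noncomputable section

namespace AStable

/-! ## Metric geometry -/

section Metric

variable {Y : Type u} [MetricSpace Y] {Z : Type v} [MetricSpace Z]

/-- The Gromov product of `x` and `y` based at `w`. -/
def gromovProduct (x y w : Y) : ℝ := (dist x w + dist y w - dist x y) / 2

variable (Y) in
/-- `δ` is a hyperbolicity constant for `Y` (four-point condition). -/
def IsHyperbolicityConstant (δ : ℝ) : Prop :=
  0 < δ ∧ ∀ w x y z : Y,
    min (gromovProduct x y w) (gromovProduct y z w) - δ ≤ gromovProduct x z w

variable (Y) in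
/-- Gromov-hyperbolic metric spaces. -/
def IsGromovHyperbolic : Prop := ∃ δ : ℝ, IsHyperbolicityConstant Y δ

/-- `s` is a geodesic segment from `x` to `y`: the image of an isometric embedding of the interval
`[0, d(x, y)]` with endpoints `x` and `y`. -/
def IsGeodesicSegment (s : Set Y) (x y : Y) : Prop :=
  ∃ c : ℝ → Y, c 0 = x ∧ c (dist x y) = y ∧
    (∀ a ∈ Icc (0 : ℝ) (dist x y), ∀ b ∈ Icc (0 : ℝ) (dist x y), dist (c a) (c b) = |a - b|) ∧
    s = c '' Icc (0 : ℝ) (dist x y)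

variable (Y) in
/-- Geodesic metric spaces: any two points are joined by a geodesic segment. -/
def IsGeodesicSpace : Prop := ∀ x y : Y, ∃ s : Set Y, IsGeodesicSegment s x y

/-- A subset `W` is quasi-convex if, for some `η > 0`, any two points of `W` are joined by a
geodesic segment contained in the `η`-neighbourhood of `W`. -/
def IsQuasiConvexSet (W : Set Y) : Prop :=
  ∃ η : ℝ, 0 < η ∧ ∀ x ∈ W, ∀ y ∈ W, ∃ s : Set Y,
    IsGeodesicSegment s x y ∧ ∀ p ∈ s, ∃ q ∈ W, dist p q ≤ η

/-- `f` is a `(K, C)` quasi-isometric embedding. -/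
def IsQIEmbedding (K C : ℝ) (f : Y → Z) : Prop :=
  ∀ x z : Y, (1 / K) * dist x z - C ≤ dist (f x) (f z) ∧ dist (f x) (f z) ≤ K * dist x z + C

end Metric

/-! ## Cayley graphs and their boundary -/

section Cayley

/-- A finite generating set of a group. -/
structure FinGenSet (Γ : Type u) [Group Γ] where
  /-- the underlying finite set -/
  gens : Finset Γ
  closure_gens : Subgroup.closure (gens : Set Γ) = ⊤

variable {Γ : Type u} [Group Γ]

/-- The Cayley graph of `Γ` with respect to `S`: distinct `g, h` are adjacent if and only if
`h = g * s` or `g = h * s` for some `s ∈ S`, so that `Γ` acts by left multiplication. -/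
abbrev FinGenSet.graph (S : FinGenSet Γ) : SimpleGraph Γ := SimpleGraph.mulCayley (S.gens : Set Γ)

theorem FinGenSet.reachable_mul (S : FinGenSet Γ) (g a : Γ) : S.graph.Reachable a (a * g) := by
  have hg : g ∈ Subgroup.closure (S.gens : Set Γ) := by rw [S.closure_gens]; trivial
  induction hg using Subgroup.closure_induction generalizing a with
  | mem s hs =>
    by_cases h : a = a * s
    · rw [← h]
    · exact SimpleGraph.Adj.reachable
        ((SimpleGraph.mulCayley_adj _ _ _).2 ⟨h, Or.inl (by simpa using hs)⟩)
  | one => simp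
  | mul x y _ _ hx hy => exact (hx a).trans (by rw [← mul_assoc]; exact hy _)
  | inv x _ hx => simpa using (hx (a * x⁻¹)).symm

theorem FinGenSet.connected (S : FinGenSet Γ) : S.graph.Connected :=
  haveI : Nonempty Γ := ⟨1⟩
  ⟨fun a b => by simpa using S.reachable_mul (a⁻¹ * b) a⟩

theorem FinGenSet.graph_dist_mul_left_le (S : FinGenSet Γ) (a g h : Γ) :
    S.graph.dist (a * g) (a * h) ≤ S.graph.dist g h := by
  obtain ⟨p, hp⟩ := S.connected.exists_walk_length_eq_dist g h
  let f : S.graph →g S.graph :=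
    ⟨fun x => a * x, fun {_ _} hxy => SimpleGraph.mulCayley_adj_mul_iff_right.2 hxy⟩
  rw [← hp, ← SimpleGraph.Walk.length_map f p]
  exact SimpleGraph.dist_le _

/-- The group `Γ`, seen as the vertex set of its Cayley graph with respect to `S`. -/
def Cayley (_S : FinGenSet Γ) : Type u := Γ

/-- The word metric `d_S`: the path metric of the Cayley graph with edges of length one, on the
vertices. -/
instance (S : FinGenSet Γ) : MetricSpace (Cayley S) where
  dist g h := (S.graph.dist (show Γ from g) (show Γ from h) : ℝ)
  dist_self g := by exact_mod_cast SimpleGraph.dist_self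
  dist_comm g h := by rw [SimpleGraph.dist_comm]
  dist_triangle g h k := by exact_mod_cast S.connected.dist_triangle
  eq_of_dist_eq_zero {g h} H := S.connected.dist_eq_zero_iff.1 (by exact_mod_cast H)

/-- `Γ` acts on its Cayley graph by left multiplication. -/
instance (S : FinGenSet Γ) : MulAction Γ (Cayley S) where
  smul a g := (a * (show Γ from g) : Γ)
  one_smul g := one_mul (show Γ from g)
  mul_smul a b g := mul_assoc a b (show Γ from g)

theorem Cayley.dist_smul_le (S : FinGenSet Γ) (a : Γ) (g h : Cayley S) :
    dist (a • g) (a • h) ≤ dist g h :=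
  Nat.cast_le.2 (S.graph_dist_mul_left_le a g h)

theorem Cayley.dist_smul (S : FinGenSet Γ) (a : Γ) (g h : Cayley S) :
    dist (a • g) (a • h) = dist g h :=
  le_antisymm (Cayley.dist_smul_le S a g h)
    (by simpa using Cayley.dist_smul_le S a⁻¹ (a • g) (a • h))

variable (Γ) in
/-- Hyperbolic groups: some Cayley graph with respect to a finite generating set is
Gromov-hyperbolic. -/
def IsHyperbolicGroup : Prop := ∃ S : FinGenSet Γ, IsGromovHyperbolic (Cayley S)

/-- Geodesic rays of the Cayley graph, given by their successive vertices. -/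
def GeodesicRay (S : FinGenSet Γ) : Type u := {r : ℕ → Cayley S // Isometry r}

/-- Two geodesic rays are asymptotic if they remain at bounded distance from each other. -/
def raySetoid (S : FinGenSet Γ) : Setoid (GeodesicRay S) where
  r r₁ r₂ := ∃ D : ℝ, ∀ n : ℕ, dist (r₁.1 n) (r₂.1 n) ≤ D
  iseqv :=
    { refl := fun r => ⟨0, fun n => by simp⟩
      symm := fun ⟨D, h⟩ => ⟨D, fun n => by rw [dist_comm]; exact h n⟩
      trans := fun ⟨D, h⟩ ⟨E, k⟩ =>
        ⟨D + E, fun n => (dist_triangle _ _ _).trans (add_le_add (h n) (k n))⟩ }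

/-- The Gromov boundary of the Cayley graph: geodesic rays up to asymptoticity. -/
def Boundary (S : FinGenSet Γ) : Type u := Quotient (raySetoid S)

/-- The extended action of `Γ` on the Gromov boundary of its Cayley graph. -/
def boundaryAct (S : FinGenSet Γ) (a : Γ) : Boundary S → Boundary S :=
  Quotient.map (sa := raySetoid S) (sb := raySetoid S)
    (fun r => ⟨fun n => a • r.1 n,
      Isometry.of_dist_eq fun m n => by rw [Cayley.dist_smul, r.2.dist_eq]⟩)
    (fun _ _ ⟨D, h⟩ => ⟨D, fun n => (Cayley.dist_smul S _ _ _).trans_le (h n)⟩)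

/-- Bi-infinite geodesics of the Cayley graph, given by their successive vertices:
`d_S(l m, l n) = |m - n|` for all integers `m, n`. -/
def GeodesicLine (S : FinGenSet Γ) : Type u := {l : ℤ → Cayley S // Isometry l}

/-- The endpoint at `+∞` of a bi-infinite geodesic. -/
def GeodesicLine.posEnd {S : FinGenSet Γ} (l : GeodesicLine S) : Boundary S :=
  Quotient.mk (raySetoid S) ⟨fun n => l.1 (n : ℤ), Isometry.of_dist_eq fun m n => by
    rw [l.2.dist_eq]; simp [Int.dist_eq, Nat.dist_eq]⟩

/-- The endpoint at `-∞` of a bi-infinite geodesic. -/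
def GeodesicLine.negEnd {S : FinGenSet Γ} (l : GeodesicLine S) : Boundary S :=
  Quotient.mk (raySetoid S) ⟨fun n => l.1 (-(n : ℤ)), Isometry.of_dist_eq fun m n => by
    rw [l.2.dist_eq]; simp [Int.dist_eq, Nat.dist_eq]⟩

/-- `L_S(γ)`: the bi-infinite geodesics of the Cayley graph which connect two distinct fixed points
of `γ` in the boundary. An element of infinite order of a hyperbolic group has exactly two fixed
points in the boundary, so these are the geodesics connecting `γ₋` and `γ₊` (in either
direction). -/
def axisGeodesics (S : FinGenSet Γ) (γ : Γ) : Set (GeodesicLine S) :=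
  {l | boundaryAct S γ l.negEnd = l.negEnd ∧ boundaryAct S γ l.posEnd = l.posEnd ∧
    l.negEnd ≠ l.posEnd}

/-- `L_S(A)`: the union of the `L_S(a)` over the elements `a` of infinite order of `A`. -/
def axisGeodesicsOf (S : FinGenSet Γ) (A : Set Γ) : Set (GeodesicLine S) :=
  {l | ∃ a ∈ A, ¬ IsOfFinOrder a ∧ l ∈ axisGeodesics S a}

/-- `A` is invariant under every automorphism of `Γ`. -/
def IsAutInvariant (A : Set Γ) : Prop := ∀ φ : MulAut Γ, φ '' A = A

end Cayley

/-! ## Isometry groups, representations, outer automorphisms -/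

section Representations

/-- The compact-open topology on `Isom(X)`. -/
instance isomTopology (X : Type v) [MetricSpace X] : TopologicalSpace (X ≃ᵢ X) :=
  TopologicalSpace.induced (fun g => (⟨g, g.continuous⟩ : C(X, X))) inferInstance

variable (Γ : Type u) [Group Γ] (X : Type v) [MetricSpace X]

/-- `R(Γ, G)` with `G = Isom(X)`. -/
abbrev Rep : Type (max u v) := Γ →* (X ≃ᵢ X)

variable {Γ} in
/-- The topology on `R(Γ, G)` as a subset of the product `G^S`. -/
abbrev repTopology (S : FinGenSet Γ) : TopologicalSpace (Rep Γ X) :=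
  TopologicalSpace.induced (fun ρ => fun s : S.gens => ρ (s : Γ)) Pi.topologicalSpace

/-- Conjugacy of representations under inner automorphisms of `G`. -/
def conjSetoid : Setoid (Rep Γ X) where
  r ρ σ := ∃ g : X ≃ᵢ X, σ = (MulAut.conj g).toMonoidHom.comp ρ
  iseqv :=
    { refl := fun ρ => ⟨1, by ext; simp⟩
      symm := by
        rintro ρ _ ⟨g, rfl⟩
        exact ⟨g⁻¹, by ext1 γ; simp [mul_assoc]⟩
      trans := by
        rintro ρ _ _ ⟨g, rfl⟩ ⟨h, rfl⟩
        exact ⟨h * g, by ext1 γ; simp [mul_assoc]⟩ }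

/-- `X(Γ, G)`: conjugacy classes of representations of `Γ` in `G = Isom(X)`. -/
def RepClass : Type (max u v) := Quotient (conjSetoid Γ X)

variable {Γ X}

/-- The conjugacy class of a representation. -/
def Rep.cls (ρ : Rep Γ X) : RepClass Γ X := Quotient.mk (conjSetoid Γ X) ρ

variable (X) in
/-- The quotient topology on `X(Γ, G)`. -/
abbrev classTopology (S : FinGenSet Γ) : TopologicalSpace (RepClass Γ X) :=
  TopologicalSpace.coinduced Rep.cls (repTopology X S)

theorem Rep.cls_eq_iff (ρ σ : Rep Γ X) :
    ρ.cls = σ.cls ↔ ∃ g : X ≃ᵢ X, σ = (MulAut.conj g).toMonoidHom.comp ρ :=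
  Quotient.eq (r := conjSetoid Γ X)

variable (Γ) in
/-- The subgroup `Inn(Γ)` of inner automorphisms of `Γ`. -/
def Inn : Subgroup (MulAut Γ) := (MulAut.conj : Γ →* MulAut Γ).range

instance : (Inn Γ).Normal where
  conj_mem := by
    rintro _ ⟨g, rfl⟩ φ
    exact ⟨φ g, by ext h; simp [MulAut.mul_apply]⟩

variable (Γ) in
/-- `Out(Γ) = Aut(Γ) / Inn(Γ)`. -/
abbrev Out : Type u := MulAut Γ ⧸ Inn Γ

/-- The action of `Aut(Γ)` on `X(Γ, G)`: `φ · [ρ] = [ρ ∘ φ⁻¹]`. -/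
def autAct (φ : MulAut Γ) : RepClass Γ X → RepClass Γ X :=
  Quotient.map (sa := conjSetoid Γ X) (sb := conjSetoid Γ X)
    (fun ρ => ρ.comp (φ⁻¹).toMonoidHom)
    (by rintro ρ _ ⟨g, rfl⟩; exact ⟨g, rfl⟩)

theorem autAct_cls (φ : MulAut Γ) (ρ : Rep Γ X) :
    autAct φ ρ.cls = Rep.cls (ρ.comp (φ⁻¹).toMonoidHom) := rfl

theorem autAct_mul (φ ψ : MulAut Γ) (p : RepClass Γ X) :
    autAct (φ * ψ) p = autAct φ (autAct ψ p) := by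
  induction p using Quotient.inductionOn with
  | h ρ =>
    change autAct _ ρ.cls = autAct _ (autAct _ ρ.cls)
    simp only [autAct_cls]
    congr 1

theorem autAct_conj (g : Γ) (p : RepClass Γ X) : autAct (MulAut.conj g) p = p := by
  induction p using Quotient.inductionOn with
  | h ρ =>
    change autAct _ ρ.cls = ρ.cls
    rw [autAct_cls, Rep.cls_eq_iff]
    refine ⟨ρ g, ?_⟩
    ext1 γ
    change ρ γ = ρ g * ρ ((MulAut.conj g)⁻¹ γ) * (ρ g)⁻¹
    rw [MulAut.conj_inv_apply, ← map_inv, ← map_mul, ← map_mul]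
    congr 1
    group

/-- The action of `Out(Γ)` on `X(Γ, G)` induced by that of `Aut(Γ)`. -/
instance : MulAction (Out Γ) (RepClass Γ X) where
  smul o p := Quotient.liftOn' o (fun φ => autAct φ p) (by
    intro φ ψ h
    obtain ⟨g, hg⟩ := QuotientGroup.leftRel_apply.1 h
    have : ψ = φ * MulAut.conj g := by rw [hg]; simp
    simp only [this, autAct_mul, autAct_conj])
  one_smul p := by
    have := autAct_conj (1 : Γ) p
    rw [map_one] at this
    exact this
  mul_smul o₁ o₂ p := by
    induction o₁ using Quotient.inductionOn'
    induction o₂ using Quotient.inductionOn'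
    exact autAct_mul _ _ p

/-! ## Quasi-convex and stable representations -/

/-- `ρ` is quasi-convex: its kernel is finite and its image is a quasi-convex subgroup of `G`, i.e.
a discrete subgroup one of whose orbits in `X` is quasi-convex. -/
def IsQuasiConvexRep (ρ : Rep Γ X) : Prop :=
  Finite ρ.ker ∧ DiscreteTopology ρ.range ∧
    ∃ x : X, IsQuasiConvexSet {y : X | ∃ g ∈ ρ.range, y = g x}

variable (Γ X) in
/-- `QC(Γ, G)`: conjugacy classes of quasi-convex representations. -/
def QC : Set (RepClass Γ X) := Rep.cls '' {ρ | IsQuasiConvexRep ρ}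

/-- The orbit map `τ_{ρ,x}` on the vertices of the Cayley graph. -/
def orbitMap (S : FinGenSet Γ) (ρ : Rep Γ X) (x : X) : Cayley S → X :=
  fun γ => ρ (show Γ from γ) x

/-- `ρ` is `(K, C)` `A`-stable (with respect to `S`): for some base point `x`, the orbit map
sends every geodesic `l ∈ L_S(A)`, parametrized by its vertices, to a `(K, C)` quasi-geodesic. -/
def IsStableWith (S : FinGenSet Γ) (A : Set Γ) (K C : ℝ) (ρ : Rep Γ X) : Prop :=
  ∃ x : X, ∀ l ∈ axisGeodesicsOf S A, IsQIEmbedding K C (fun n : ℤ => orbitMap S ρ x (l.1 n))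

/-- `ρ` is `A`-stable. -/
def IsStable (S : FinGenSet Γ) (A : Set Γ) (ρ : Rep Γ X) : Prop :=
  ∃ K C : ℝ, 1 ≤ K ∧ 0 ≤ C ∧ IsStableWith S A K C ρ

variable (X) in
/-- `S_A(Γ, G)`: conjugacy classes of `A`-stable representations. -/
def stableSet (S : FinGenSet Γ) (A : Set Γ) : Set (RepClass Γ X) :=
  Rep.cls '' {ρ | IsStable S A ρ}

end Representations

end AStable

end

/-! The engine is the Morse lemma `exists_bound_gromovProduct_quasiGeodesic`, with a bound depending
only on the hyperbolicity and quasi-geodesic constants. It rests on the four-point condition: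
bisecting a path costs one `δ` per halving, so a path that avoids the ball of radius `D` about `z`
and joins points of small Gromov product at `z` has length exponential in `D`, whereas a
quasi-geodesic detour has length linear in `D`.

Openness and uniform constants: by `exists_local_to_global`, a path that is quasi-geodesic on all
windows of some length `L` is a global quasi-geodesic. By equivariance, the distances seen in such
windows, along all lines at once, are displacements of the base point by elements of the ball of
radius `L` of `Γ`. That ball is finite, so representations close to `ρ₀` change these displacements
by less than `1`.

Invariance under `Out(Γ)`: an automorphism `φ` is bi-Lipschitz for the word metric, so it sends a
line of `L_S(a)` to a path that follows a line of `L_S(φ a)` within a distance independent of the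
line (`exists_geodesicLine_shadowing`). The estimate on the second line transfers to the first.

Quasi-convex representations: discreteness and finite kernel make the action on `X` proper, and a
Milnor–Švarc argument shows that the whole orbit map is a quasi-isometric embedding. -/

noncomputable section

namespace AStable

/-! ### Geodesics stay near quasi-geodesics. -/

section Hyperbolic

variable {Y : Type u} [MetricSpace Y]

theorem gromovProduct_comm (x y w : Y) : gromovProduct x y w = gromovProduct y x w := by
  simp only [gromovProduct, dist_comm x y]; ring

variable (Y) in
/-- Every pair of points is joined by a path that is geodesic up to an error of `1`. -/
def IsRoughlyGeodesic : Prop :=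
  ∀ x y : Y, ∀ t ∈ Icc (0 : ℝ) (dist x y),
    ∃ z : Y, dist x z ≤ t + 1 ∧ dist z y ≤ dist x y - t + 1

theorem IsGeodesicSpace.isRoughlyGeodesic (h : IsGeodesicSpace Y) : IsRoughlyGeodesic Y := by
  intro x y t ht
  obtain ⟨_, c, h0, h1, hc, -⟩ := h x y
  have hd : (0 : ℝ) ≤ dist x y := dist_nonneg
  refine ⟨c t, ?_, ?_⟩
  · have := hc 0 ⟨le_rfl, hd⟩ t ht
    rw [h0, zero_sub, abs_neg, abs_of_nonneg ht.1] at this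
    linarith
  · have := hc t ht _ ⟨hd, le_rfl⟩
    rw [h1, abs_sub_comm, abs_of_nonneg (sub_nonneg.2 ht.2)] at this
    linarith

/-- The four-point condition in terms of distances. -/
theorem IsHyperbolicityConstant.dist_add_dist_le {δ : ℝ} (h : IsHyperbolicityConstant Y δ)
    (p q x y : Y) :
    dist p q + dist x y ≤
      max (dist p x + dist q y) (dist p y + dist q x) + 2 * δ := by
  have := h.2 x p y q
  simp only [gromovProduct] at this
  rw [dist_comm y x, dist_comm y q] at this
  rcases min_cases ((dist p x + dist x y - dist p y) / 2)
    ((dist x y + dist q x - dist q y) / 2) with ⟨e, -⟩ | ⟨e, -⟩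
  · rw [e] at this
    have := le_max_right (dist p x + dist q y) (dist p y + dist q x)
    linarith
  · rw [e] at this
    have := le_max_left (dist p x + dist q y) (dist p y + dist q x)
    linarith

/-- Induction by bisection: each halving costs one `δ`, and a single jump of length at most `J`
outside the ball of radius `B` has product at least `B - J / 2`. -/
theorem IsHyperbolicityConstant.le_gromovProduct_of_chain {δ : ℝ}
    (h : IsHyperbolicityConstant Y δ) {B J : ℝ} (z : Y) (m : ℕ) :
    ∀ (f : ℕ → Y) (n : ℕ), n ≤ 2 ^ m → (∀ i ≤ n, B ≤ dist (f i) z) →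
      (∀ i < n, dist (f i) (f (i + 1)) ≤ J) → 0 ≤ J →
      B - J / 2 - m * δ ≤ gromovProduct (f 0) (f n) z := by
  have hδ := h.1
  induction m with
  | zero =>
    intro f n hn hB hJ hJ0
    have h0 := hB 0 (Nat.zero_le _)
    simp only [gromovProduct, CharP.cast_eq_zero]
    obtain rfl | rfl : n = 0 ∨ n = 1 := by simp at hn; omega
    · rw [dist_self]; linarith
    · have := hJ 0 one_pos
      have := hB 1 le_rfl
      simp only [zero_add] at *
      linarith
  | succ m ih =>
    intro f n hn hB hJ hJ0
    push_cast
    rcases le_total n (2 ^ m) with hm | hm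
    · have := ih f n hm hB hJ hJ0
      linarith
    · have h1 := ih f (2 ^ m) le_rfl (fun i hi => hB i (hi.trans hm))
        (fun i hi => hJ i (hi.trans_le hm)) hJ0
      have h2 := ih (fun i => f (2 ^ m + i)) (n - 2 ^ m) (by rw [pow_succ] at hn; omega)
        (fun i hi => hB _ (by omega)) (fun i hi => hJ _ (by omega)) hJ0
      simp only [add_zero, Nat.add_sub_of_le hm] at h2
      have h3 := h.2 z (f 0) (f (2 ^ m)) (f n)
      have := le_min h1 h2
      linarith

/-- A path staying at distance at least `B` from `z` has exponential length unless its endpoints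
have a large Gromov product based at `z`. -/
theorem IsHyperbolicityConstant.le_gromovProduct_of_far {δ : ℝ}
    (h : IsHyperbolicityConstant Y δ) {B J : ℝ} {z : Y} {m N : ℕ} {f : ℕ → Y}
    (hB : ∀ i ≤ N, B ≤ dist (f i) z) (hJ : ∀ i < N, dist (f i) (f (i + 1)) ≤ J) (hJ0 : 0 ≤ J)
    {i j : ℕ} (hi : i ≤ N) (hj : j ≤ N) (hij : |(i : ℝ) - j| ≤ 2 ^ m) :
    B - J / 2 - m * δ ≤ gromovProduct (f i) (f j) z := by
  wlog hle : i ≤ j generalizing i j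
  · rw [gromovProduct_comm]
    exact this hj hi (by rwa [abs_sub_comm]) (le_of_not_ge hle)
  have := h.le_gromovProduct_of_chain (B := B) (J := J) z m (fun k => f (i + k)) (j - i) ?_
    (fun k hk => hB _ (by omega)) (fun k hk => hJ _ (by omega)) hJ0
  · simpa [Nat.add_sub_of_le hle] using this
  · rw [abs_sub_comm, abs_of_nonneg (sub_nonneg.2 (Nat.cast_le.2 hle)), ← Nat.cast_sub hle] at hij
    exact_mod_cast hij

/-- A discrete intermediate value theorem. -/
theorem exists_crossing {α : Type*} [LinearOrder α] (g : ℕ → α) {a : α} {n : ℕ} (h0 : g 0 ≤ a)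
    (hn : a < g n) : ∃ t < n, g t ≤ a ∧ a < g (t + 1) := by
  induction n with
  | zero => exact absurd h0 (not_le.2 hn)
  | succ n ih =>
    rcases le_or_gt (g n) a with h | h
    · exact ⟨n, n.lt_succ_self, h, hn⟩
    · obtain ⟨t, ht, h'⟩ := ih h
      exact ⟨t, ht.trans n.lt_succ_self, h'⟩

/-- Logarithmic self-improvement: a quantity bounded by the logarithm of itself is bounded. -/
theorem exists_bound_of_le_log (A B c e : ℝ) (hA : 0 ≤ A) (he : 0 ≤ e) :
    ∃ D₀ : ℝ, ∀ D : ℝ, (∀ m : ℕ, A * D + B ≤ 2 ^ m → D ≤ c + m * e) → D ≤ D₀ := by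
  have hlim : Filter.Tendsto (fun n : ℕ => A * (e + 1) * ((n : ℝ) ^ 1 / 2 ^ n) +
      (A * (c + (e + 1)) + B) * ((n : ℝ) ^ 0 / 2 ^ n)) Filter.atTop (𝓝 (A * (e + 1) * 0 +
        (A * (c + (e + 1)) + B) * 0)) :=
    ((tendsto_pow_const_div_const_pow_of_one_lt 1 one_lt_two).const_mul _).add
      ((tendsto_pow_const_div_const_pow_of_one_lt 0 one_lt_two).const_mul _)
  have hev := hlim.eventually_le_const (u := 1) (by simp)
  obtain ⟨n₀, hn₀⟩ := (hev.and (Filter.eventually_ge_atTop 1)).exists_forall_of_atTop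
  refine ⟨c + n₀ * (e + 1), fun D hD => ?_⟩
  by_contra! hlt
  -- For this `n`, `A * D + B` is bounded by an affine function of `n`, hence by `2 ^ n`. Then `D ≤
  -- c + n * e` contradicts `n * (e + 1) ≤ D - c`; dividing by `e + 1` creates the gap and also
  -- covers `e = 0`.
  set n := ⌊(D - c) / (e + 1)⌋₊ with hn
  have he1 : 0 < e + 1 := by linarith
  have hq : (n₀ : ℝ) ≤ (D - c) / (e + 1) := by rw [le_div_iff₀ he1]; linarith
  have hnn : n₀ ≤ n := Nat.le_floor hq
  have h1 : (n : ℝ) * (e + 1) ≤ D - c :=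
    (le_div_iff₀ he1).1 (Nat.floor_le (by positivity |> fun h : (0:ℝ) ≤ n₀ => h.trans hq))
  have h2 : D - c < (n + 1) * (e + 1) := (div_lt_iff₀ he1).1 (Nat.lt_floor_add_one _)
  obtain ⟨h3, h4⟩ := hn₀ n hnn
  have hpow : (0 : ℝ) < 2 ^ n := by positivity
  have h5 : A * (e + 1) * n + (A * (c + (e + 1)) + B) ≤ 2 ^ n := by
    have : A * (e + 1) * ((n : ℝ) ^ 1 / 2 ^ n) + (A * (c + (e + 1)) + B) * ((n : ℝ) ^ 0 / 2 ^ n)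
        = (A * (e + 1) * n + (A * (c + (e + 1)) + B)) / 2 ^ n := by
      rw [pow_one, pow_zero]; ring
    rw [this, div_le_one hpow] at h3
    exact h3
  have h6 := hD n (by nlinarith [mul_le_mul_of_nonneg_left h2.le hA])
  have : (1 : ℝ) ≤ n := by exact_mod_cast h4
  nlinarith

/-- `f` restricted to `{0, …, N}` is a `(K, C)` quasi-geodesic. -/
def IsQuasiGeodesicTo (K C : ℝ) (f : ℕ → Y) (N : ℕ) : Prop :=
  ∀ i ≤ N, ∀ j ≤ N, |(i : ℝ) - j| ≤ K * (dist (f i) (f j) + C) ∧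
    dist (f i) (f j) ≤ K * |(i : ℝ) - j| + C

theorem IsQuasiGeodesicTo.dist_succ_le {K C : ℝ} {f : ℕ → Y} {N : ℕ}
    (h : IsQuasiGeodesicTo K C f N) {i : ℕ} (hi : i < N) : dist (f i) (f (i + 1)) ≤ K + C := by
  have := (h i hi.le (i + 1) hi).2
  push_cast at this
  rwa [sub_add_cancel_left, abs_neg, abs_one, mul_one] at this

/-- `z` lists the points at integer distance from `p` of a rough geodesic from `p` to `q`. -/
theorem IsRoughlyGeodesic.exists_points (hg : IsRoughlyGeodesic Y) (p q : Y) :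
    ∃ z : ℕ → Y, ∀ t ≤ ⌊dist p q⌋₊,
      dist p (z t) ≤ t + 1 ∧ dist (z t) q ≤ dist p q - t + 1 := by
  have h : ∀ t : ℕ, ∃ z : Y, t ≤ ⌊dist p q⌋₊ →
      dist p z ≤ t + 1 ∧ dist z q ≤ dist p q - t + 1 := by
    intro t
    by_cases ht : t ≤ ⌊dist p q⌋₊
    · obtain ⟨z, hz⟩ := hg p q t ⟨t.cast_nonneg, (Nat.le_floor_iff dist_nonneg).1 ht⟩
      exact ⟨z, fun _ => hz⟩
    · exact ⟨p, fun h => absurd h ht⟩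
  exact ⟨fun t => (h t).choose, fun t => (h t).choose_spec⟩

/-- `dist p q` cancels in the four-point condition. Thus points chosen independently along rough
geodesics still form a path with bounded jumps. -/
theorem IsHyperbolicityConstant.dist_points_le {δ : ℝ} (h : IsHyperbolicityConstant Y δ)
    {p q z w : Y} {s t : ℝ} (hz : dist p z ≤ s + 1) (hz' : dist z q ≤ dist p q - s + 1)
    (hw : dist p w ≤ t + 1) (hw' : dist w q ≤ dist p q - t + 1) :
    dist z w ≤ |s - t| + 2 + 2 * δ := by
  have := h.dist_add_dist_le z w p q
  rw [dist_comm z p, dist_comm w p] at this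
  rcases max_cases (dist p z + dist w q) (dist z q + dist p w) with ⟨e, -⟩ | ⟨e, -⟩ <;>
    rw [e] at this
  · linarith [le_abs_self (s - t)]
  · linarith [neg_abs_le (s - t)]

/-- The points of a geodesic are close to any quasi-geodesic with the same endpoints. -/
theorem exists_bound_geodesic_near_quasiGeodesic (δ K C : ℝ) (hδ : 0 < δ) (hK : 1 ≤ K)
    (hC : 0 ≤ C) : ∃ D₀ : ℝ, ∀ (Y : Type u) [MetricSpace Y], IsHyperbolicityConstant Y δ →
      ∀ (f : ℕ → Y) (N : ℕ), IsQuasiGeodesicTo K C f N → ∀ z : ℕ → Y,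
        (∀ t ≤ ⌊dist (f 0) (f N)⌋₊, dist (f 0) (z t) ≤ t + 1 ∧
          dist (z t) (f N) ≤ dist (f 0) (f N) - t + 1) →
        ∀ t ≤ ⌊dist (f 0) (f N)⌋₊, ∃ i ≤ N, dist (z t) (f i) ≤ D₀ := by
  -- The affine expression bounds the index gap of the detour (`hlen`, `hidx`); the bound on `D`
  -- comes from comparing Gromov products at `z t₀`.
  obtain ⟨D₀, hD₀⟩ := exists_bound_of_le_log (6 * K) (K * (6 + 2 * δ + C)) (3 + K + C + 2 * δ) δ
    (by positivity) hδ.le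
  refine ⟨D₀, fun Y _ hY f N hf z hz => ?_⟩
  set T := ⌊dist (f 0) (f N)⌋₊ with hT
  have hTd : (T : ℝ) ≤ dist (f 0) (f N) := Nat.floor_le dist_nonneg
  have hTd' : dist (f 0) (f N) < T + 1 := Nat.lt_floor_add_one _
  have hmin : ∀ t, ∃ i ≤ N, ∀ j ≤ N, dist (z t) (f i) ≤ dist (z t) (f j) := by
    intro t
    obtain ⟨i, hi, h⟩ := (Finset.range (N + 1)).exists_min_image (fun i => dist (z t) (f i))
      ⟨0, by simp⟩
    exact ⟨i, by simpa [Nat.lt_succ_iff] using hi,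
      fun j hj => h j (by simpa [Nat.lt_succ_iff] using hj)⟩
  choose i hiN hi using hmin
  obtain ⟨t₀, ht₀, hmax⟩ := (Finset.range (T + 1)).exists_max_image
    (fun t => dist (z t) (f (i t))) ⟨0, by simp⟩
  replace ht₀ : t₀ ≤ T := by simpa [Nat.lt_succ_iff] using ht₀
  replace hmax : ∀ t ≤ T, dist (z t) (f (i t)) ≤ dist (z t₀) (f (i t₀)) :=
    fun t ht => hmax t (by simpa [Nat.lt_succ_iff] using ht)
  set D := dist (z t₀) (f (i t₀)) with hD
  have hD0 : 0 ≤ D := dist_nonneg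
  suffices D ≤ D₀ from fun t ht => ⟨i t, hiN t, (hmax t ht).trans this⟩
  refine hD₀ D fun m hm => ?_
  have hfar : ∀ j ≤ N, D ≤ dist (f j) (z t₀) := fun j hj => by
    rw [dist_comm]; exact hi t₀ j hj
  -- Moving `2 * D` along the geodesic before jumping at most `D` to `f` leaves a product of about
  -- `D` with the endpoint. If the geodesic ends earlier, its end is already within `2` of the
  -- chosen point of `f`.
  set r := ⌈2 * D⌉₊ with hr
  have hr1 : 2 * D ≤ r := Nat.le_ceil _
  have hr2 : (r : ℝ) < 2 * D + 1 := Nat.ceil_lt_add_one (by positivity)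
  obtain ⟨hp0, hq0⟩ := hz t₀ ht₀
  have hpq := dist_triangle (f 0) (z t₀) (f N)
  -- the left end
  have hleft : ∃ t₁ ≤ t₀, t₀ ≤ t₁ + r ∧ D - 2 ≤ gromovProduct (f 0) (f (i t₁)) (z t₀) := by
    rcases le_or_gt r t₀ with h | h
    · refine ⟨t₀ - r, Nat.sub_le _ _, by omega, ?_⟩
      obtain ⟨hp1, hq1⟩ := hz (t₀ - r) (by omega)
      have h1 := hmax (t₀ - r) (by omega)
      have h2 := hfar _ (hiN (t₀ - r))
      have h3 := dist_triangle (f 0) (z (t₀ - r)) (f (i (t₀ - r)))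
      rw [Nat.cast_sub h] at hp1
      simp only [gromovProduct]
      linarith
    · refine ⟨0, Nat.zero_le _, by omega, ?_⟩
      obtain ⟨hp1, -⟩ := hz 0 (Nat.zero_le _)
      have h1 := hi 0 0 (Nat.zero_le _)
      have h2 := hfar _ (hiN 0)
      have h4 := hfar 0 (Nat.zero_le _)
      have h3 := dist_triangle (f 0) (z 0) (f (i 0))
      rw [dist_comm (z 0) (f 0)] at h1
      simp only [gromovProduct, CharP.cast_eq_zero] at *
      linarith
  have hright : ∃ t₂ ≤ T, t₀ ≤ t₂ ∧ t₂ ≤ t₀ + r ∧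
      D - 2 ≤ gromovProduct (f (i t₂)) (f N) (z t₀) := by
    rcases le_or_gt (t₀ + r) T with h | h
    · refine ⟨t₀ + r, h, by omega, le_rfl, ?_⟩
      obtain ⟨hp1, hq1⟩ := hz (t₀ + r) h
      have h1 := hmax (t₀ + r) h
      have h2 := hfar _ (hiN (t₀ + r))
      have h3 := dist_triangle (f (i (t₀ + r))) (z (t₀ + r)) (f N)
      rw [dist_comm _ (z (t₀ + r))] at h3
      push_cast at hq1
      simp only [gromovProduct]
      rw [dist_comm (f N)]
      linarith
    · refine ⟨T, le_rfl, ht₀, h.le, ?_⟩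
      obtain ⟨-, hq1⟩ := hz T le_rfl
      have h1 := hi T N le_rfl
      have h2 := hfar _ (hiN T)
      have h4 := hfar N le_rfl
      have h3 := dist_triangle (f (i T)) (z T) (f N)
      rw [dist_comm _ (z T)] at h3
      simp only [gromovProduct]
      linarith
  obtain ⟨t₁, ht₁, hr₁, hg₁⟩ := hleft
  obtain ⟨t₂, ht₂T, ht₂, hr₂, hg₂⟩ := hright
  have hlen : dist (f (i t₁)) (f (i t₂)) ≤ 6 * D + 6 + 2 * δ := by
    have h1 := hY.dist_points_le (hz t₁ (ht₁.trans ht₀)).1 (hz t₁ (ht₁.trans ht₀)).2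
      (hz t₂ ht₂T).1 (hz t₂ ht₂T).2
    have h2 : |(t₁ : ℝ) - t₂| ≤ 2 * r := by
      have : (t₂ : ℝ) ≤ t₁ + 2 * r := by exact_mod_cast (by omega : t₂ ≤ t₁ + 2 * r)
      have : (t₁ : ℝ) ≤ t₂ := by exact_mod_cast ht₁.trans ht₂
      rw [abs_le]; constructor <;> linarith
    have h3 := dist_triangle4 (f (i t₁)) (z t₁) (z t₂) (f (i t₂))
    rw [dist_comm (f (i t₁)) (z t₁)] at h3
    have h4 := hmax t₁ (ht₁.trans ht₀)
    have h5 := hmax t₂ ht₂T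
    linarith
  have hidx := (hf _ (hiN t₁) _ (hiN t₂)).1
  -- The detour stays at distance `D` from `z t₀`, so its ends have product at least `D` minus a
  -- logarithmic term. Chained with the two sides, this bounds below the product of `f 0` and `f N`,
  -- which is at most `1` since `z t₀` lies on the rough geodesic.
  have hmid := hY.le_gromovProduct_of_far (m := m) hfar (fun j hj => hf.dist_succ_le hj)
    (by positivity) (hiN t₁) (hiN t₂) (by nlinarith)
  have hu := hY.2 (z t₀) (f 0) (f (i t₁)) (f (i t₂))
  have hv := hY.2 (z t₀) (f 0) (f (i t₂)) (f N)
  have hw : gromovProduct (f 0) (f N) (z t₀) ≤ 1 := by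
    simp only [gromovProduct]
    rw [dist_comm (f N)]
    linarith
  have hmδ : 0 ≤ m * δ := by positivity
  have h1 : D - 2 - (K + C) / 2 - m * δ - δ ≤ gromovProduct (f 0) (f (i t₂)) (z t₀) := by
    have e₁ : D - 2 - (K + C) / 2 - m * δ ≤ gromovProduct (f 0) (f (i t₁)) (z t₀) := by linarith
    have e₂ : D - 2 - (K + C) / 2 - m * δ ≤ gromovProduct (f (i t₁)) (f (i t₂)) (z t₀) := by
      linarith
    linarith [le_min e₁ e₂]
  have h2 : D - 2 - (K + C) / 2 - m * δ - δ ≤ gromovProduct (f (i t₂)) (f N) (z t₀) := by linarith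
  linarith [le_min h1 h2]

end Hyperbolic

/-! ### The Morse lemma, and broken paths. -/

section Morse

theorem gromovProduct_le_add {Y : Type u} [MetricSpace Y] (x y w z : Y) :
    gromovProduct x y w ≤ gromovProduct x y z + dist w z := by
  have h1 := dist_triangle x z w
  have h2 := dist_triangle y z w
  rw [dist_comm z w] at h1 h2
  simp only [gromovProduct]
  linarith

/-- Quasi-geodesics stay close to geodesics: the Gromov product of the endpoints of a quasi-geodesic
based at any of its points is bounded. -/
theorem exists_bound_gromovProduct_quasiGeodesic (δ K C : ℝ) (hδ : 0 < δ) (hK : 1 ≤ K)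
    (hC : 0 ≤ C) : ∃ a : ℝ, 0 ≤ a ∧ ∀ (Y : Type u) [MetricSpace Y], IsHyperbolicityConstant Y δ →
      IsRoughlyGeodesic Y → ∀ (f : ℕ → Y) (N : ℕ), IsQuasiGeodesicTo K C f N →
        ∀ j ≤ N, gromovProduct (f 0) (f N) (f j) ≤ a := by
  obtain ⟨D', hD'⟩ := exists_bound_geodesic_near_quasiGeodesic.{u} δ K C hδ hK hC
  obtain ⟨D, hD0, hDD⟩ : ∃ D : ℝ, 0 ≤ D ∧ D' ≤ D := ⟨max 0 D', le_max_left _ _, le_max_right _ _⟩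
  -- Two jumps of length `D` to the quasi-geodesic, and one between consecutive points of the rough
  -- geodesic.
  set E := 2 * D + 3 + 2 * δ with hE
  refine ⟨1 + D + (K * (K * (E + C)) + C), by positivity, fun Y _ hY hg f N hf j hj => ?_⟩
  obtain ⟨z, hz⟩ := hg.exists_points (f 0) (f N)
  have hnear := hD' Y hY f N hf z hz
  set T := ⌊dist (f 0) (f N)⌋₊ with hT
  have hTd' : dist (f 0) (f N) < T + 1 := Nat.lt_floor_add_one _
  have hpos : 0 ≤ K * (K * (E + C)) + C := by positivity
  have hsel : ∀ t, ∃ i, t ≤ T → i ≤ N ∧ dist (z t) (f i) ≤ D := fun t => by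
    by_cases ht : t ≤ T
    · obtain ⟨i, hi, h⟩ := hnear t ht
      exact ⟨i, fun _ => ⟨hi, h.trans hDD⟩⟩
    · exact ⟨0, fun h => absurd h ht⟩
  choose i hi using hsel
  rcases hj.eq_or_lt with rfl | hjN
  · simp only [gromovProduct, dist_self]
    linarith
  have hbase : ∀ t ≤ T, gromovProduct (f 0) (f N) (f (i t)) ≤ 1 + D := fun t ht => by
    have h1 := gromovProduct_le_add (f 0) (f N) (f (i t)) (z t)
    have h2 : gromovProduct (f 0) (f N) (z t) ≤ 1 := by
      have := hz t ht
      simp only [gromovProduct]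
      rw [dist_comm (f N)]
      linarith
    have h3 := (hi t ht).2
    rw [dist_comm] at h3
    linarith
  -- it suffices to find a nearby pair of points of `f` on both sides of `j`
  have key : ∀ k ≤ j, ∀ l ≤ N, j < l → dist (f k) (f l) ≤ E →
      gromovProduct (f 0) (f N) (f k) ≤ 1 + D →
      gromovProduct (f 0) (f N) (f j) ≤ 1 + D + (K * (K * (E + C)) + C) := by
    intro k hk l hl hjl hkl hgk
    have h1 := (hf k (hk.trans hj) l hl).1
    have h2 := (hf j hj k (hk.trans hj)).2
    have h3 : |(j : ℝ) - k| ≤ |(k : ℝ) - l| := by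
      have e1 : (k : ℝ) ≤ j := by exact_mod_cast hk
      have e2 : (j : ℝ) ≤ l := by exact_mod_cast hjl.le
      rw [abs_of_nonneg (by linarith), abs_of_nonpos (by linarith)]
      linarith
    have h4 := gromovProduct_le_add (f 0) (f N) (f j) (f k)
    have h5 : K * (dist (f k) (f l) + C) ≤ K * (E + C) := by gcongr
    have h6 : K * |(j : ℝ) - k| ≤ K * (K * (E + C)) := by
      gcongr
      exact h3.trans (h1.trans h5)
    linarith
  -- Following the nearby indices `i t`, some step passes over `j`; in the extreme cases it is the
  -- one from `0` to `i 0` or from `i T` to `N`.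
  rcases lt_or_ge j (i 0) with h0 | h0
  · refine key 0 (Nat.zero_le _) (i 0) (hi 0 (Nat.zero_le _)).1 h0 ?_ ?_
    · have h1 := (hz 0 (Nat.zero_le _)).1
      have h2 := (hi 0 (Nat.zero_le _)).2
      have h3 := dist_triangle (f 0) (z 0) (f (i 0))
      rw [Nat.cast_zero] at h1
      linarith
    · simp only [gromovProduct, dist_self]
      rw [dist_comm (f N)]
      linarith
  rcases le_or_gt (i T) j with hTj | hTj
  · refine key (i T) hTj N le_rfl hjN ?_ (hbase T le_rfl)
    have h1 := (hz T le_rfl).2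
    have h2 := (hi T le_rfl).2
    have h3 := dist_triangle (f (i T)) (z T) (f N)
    rw [dist_comm (f (i T)) (z T)] at h3
    linarith
  · obtain ⟨t, ht, h1, h2⟩ := exists_crossing i h0 hTj
    refine key (i t) h1 (i (t + 1)) (hi _ ht).1 h2 ?_ (hbase t ht.le)
    have h3 := hY.dist_points_le (hz t ht.le).1 (hz t ht.le).2 (hz (t + 1) ht).1 (hz (t + 1) ht).2
    push_cast at h3
    rw [sub_add_cancel_left, abs_neg, abs_one] at h3
    have h4 := (hi t ht.le).2
    have h5 := (hi (t + 1) ht).2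
    have h6 := dist_triangle4 (f (i t)) (z t) (z (t + 1)) (f (i (t + 1)))
    rw [dist_comm (f (i t)) (z t)] at h6
    linarith

variable {Y : Type u} [MetricSpace Y]

/-- A point close to a geodesic from `g 0` to `g N` is close to any path from `g 0` to `g N` which
is close to a geodesic. -/
theorem IsHyperbolicityConstant.exists_dist_le_of_gromovProduct_le {δ : ℝ}
    (h : IsHyperbolicityConstant Y δ) {a J : ℝ} {g : ℕ → Y} {N : ℕ}
    (hg : ∀ j ≤ N, gromovProduct (g 0) (g N) (g j) ≤ a)
    (hJ : ∀ j < N, dist (g j) (g (j + 1)) ≤ J) (hJ0 : 0 ≤ J) (ha : 0 ≤ a) {p : Y}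
    (hp : gromovProduct (g 0) (g N) p ≤ a) : ∃ j ≤ N, dist p (g j) ≤ 4 * a + J + 2 * δ := by
  -- Points at similar distances from `g 0`, both with product at most `a`, are also at similar
  -- distances from `g N`, so the four-point condition brings them close. If `p` overshoots `g N`,
  -- it does so by at most `2 * a`.
  obtain ⟨j, hj, hu⟩ : ∃ j ≤ N, |dist (g 0) p - dist (g 0) (g j)| ≤ J + 2 * a := by
    rcases le_or_gt (dist (g 0) (g N)) (dist (g 0) p) with hle | hlt
    · refine ⟨N, le_rfl, ?_⟩
      rw [abs_of_nonneg (sub_nonneg.2 hle)]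
      have : (0 : ℝ) ≤ dist (g N) p := dist_nonneg
      simp only [gromovProduct] at hp
      linarith
    · obtain ⟨t, ht, h1, h2⟩ := exists_crossing (fun j => dist (g 0) (g j))
        (by simp only [dist_self]; exact dist_nonneg) hlt
      refine ⟨t, ht.le, ?_⟩
      rw [abs_of_nonneg (sub_nonneg.2 h1)]
      have := dist_triangle (g 0) (g t) (g (t + 1))
      have := hJ t ht
      linarith
  refine ⟨j, hj, ?_⟩
  have h1 := h.dist_add_dist_le p (g j) (g 0) (g N)
  have h2 := hg j hj
  simp only [gromovProduct] at hp h2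
  rw [dist_comm p (g 0), dist_comm (g j) (g 0), dist_comm p (g N), dist_comm (g j) (g N)] at h1
  obtain ⟨hu1, hu2⟩ := abs_le.1 hu
  rcases max_cases (dist (g 0) p + dist (g N) (g j)) (dist (g N) p + dist (g 0) (g j)) with
    ⟨e, -⟩ | ⟨e, -⟩ <;> rw [e] at h1 <;> linarith

/-- A broken path whose pieces are long compared with the Gromov products at its corners makes
definite progress. -/
theorem IsHyperbolicityConstant.le_dist_of_broken {δ : ℝ} (h : IsHyperbolicityConstant Y δ)
    {a : ℝ} (ha : 0 ≤ a) {x : ℕ → Y} (hx : ∀ i, gromovProduct (x i) (x (i + 2)) (x (i + 1)) ≤ a)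
    (hd : ∀ i, 2 * a + 2 * δ + 1 ≤ dist (x i) (x (i + 1))) (n : ℕ) :
    (n : ℝ) ≤ dist (x 0) (x n) := by
  have hδ := h.1
  -- Since the pieces are long, a small product at one corner makes the product of `x (n + 1)` and
  -- `x 0` at the next corner exceed `a + δ`. The minimum in Gromov's inequality is then the other
  -- term.
  have hcorner : ∀ n, gromovProduct (x 0) (x (n + 2)) (x (n + 1)) ≤ a + δ := by
    intro n
    induction n with
    | zero => exact (hx 0).trans (by linarith)
    | succ n ih =>
      have h1 : a + δ < gromovProduct (x (n + 1)) (x 0) (x (n + 2)) := by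
        have h2 := hd (n + 1)
        simp only [gromovProduct] at ih ⊢
        rw [dist_comm (x (n + 2)) (x (n + 1))] at ih
        rw [dist_comm (x (n + 1)) (x 0)]
        rw [show n + 1 + 1 = n + 2 from rfl] at h2
        linarith
      have h3 := h.2 (x (n + 2)) (x (n + 1)) (x 0) (x (n + 3))
      have h4 : gromovProduct (x (n + 1)) (x (n + 3)) (x (n + 2)) ≤ a := hx (n + 1)
      rcases min_cases (gromovProduct (x (n + 1)) (x 0) (x (n + 2)))
        (gromovProduct (x 0) (x (n + 3)) (x (n + 2))) with ⟨e, -⟩ | ⟨e, -⟩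
      · rw [e] at h3
        linarith
      · rw [e] at h3
        change gromovProduct (x 0) (x (n + 3)) (x (n + 2)) ≤ a + δ
        linarith
  induction n with
  | zero => simp
  | succ n ih =>
    rcases n with _ | n
    · have := hd 0
      simp only [zero_add, Nat.cast_one] at *
      linarith
    · have h1 := hcorner n
      have h2 := hd (n + 1)
      simp only [gromovProduct] at h1
      rw [dist_comm (x (n + 2)) (x (n + 1))] at h1
      rw [show n + 1 + 1 = n + 2 from rfl] at h2 ⊢
      push_cast at ih ⊢
      linarith

theorem dist_le_mul_of_steps {f : ℤ → Y} {J : ℝ} (h : ∀ m, dist (f m) (f (m + 1)) ≤ J) (m : ℤ)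
    (n : ℕ) : dist (f m) (f (m + n)) ≤ J * n := by
  induction n with
  | zero => simp
  | succ n ih =>
    have h1 := dist_triangle (f m) (f (m + n)) (f (m + n + 1))
    have h2 := h (m + n)
    push_cast
    rw [← add_assoc]
    linarith

end Morse

/-! ### From local to global quasi-geodesics. -/

/-- Local quasi-geodesics of a hyperbolic space are global quasi-geodesics. -/
theorem exists_local_to_global (δ K₀ C₀ : ℝ) (hδ : 0 < δ) (hK₀ : 1 ≤ K₀) (hC₀ : 0 ≤ C₀) :
    ∃ (L : ℕ) (K C : ℝ), 1 ≤ K ∧ 0 ≤ C ∧ ∀ (Y : Type u) [MetricSpace Y],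
      IsHyperbolicityConstant Y δ → IsRoughlyGeodesic Y → ∀ f : ℤ → Y,
        (∀ (m : ℤ) (n : ℕ), n ≤ L → (1 / K₀) * n - C₀ ≤ dist (f m) (f (m + n)) ∧
          dist (f m) (f (m + n)) ≤ K₀ * n + C₀) → IsQIEmbedding K C f := by
  obtain ⟨a, ha, hmorse⟩ := exists_bound_gromovProduct_quasiGeodesic.{u} δ K₀ C₀ hδ hK₀ hC₀
  -- This makes pieces of `M` steps long enough for `le_dist_of_broken`.
  obtain ⟨M, hM⟩ := exists_nat_ge (K₀ * (2 * a + 2 * δ + 1 + C₀))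
  have hK0 : 0 < K₀ := by linarith
  have hM1 : (1 : ℝ) ≤ M := le_trans (by nlinarith) hM
  have hMpos : 0 < M := by exact_mod_cast (zero_lt_one.trans_le hM1)
  -- Each corner is the midpoint of a window of length `2 * M`. Progress is at least `1` per `M`
  -- steps; the additive constant pays for the last incomplete piece and for rounding `n / M`.
  refine ⟨2 * M, max M (K₀ + C₀), K₀ * M + C₀ + 1, le_max_of_le_left hM1, by positivity, ?_⟩
  intro Y _ hY hg f hf
  have hstep : ∀ m, dist (f m) (f (m + 1)) ≤ K₀ + C₀ := fun m => by
    simpa using (hf m 1 (by omega)).2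
  -- windows are quasi-geodesics
  have hwin : ∀ m : ℤ, IsQuasiGeodesicTo K₀ C₀ (fun i : ℕ => f (m + i)) (2 * M) := by
    intro m i hi j hj
    wlog hij : i ≤ j generalizing i j
    · have := this j hj i hi (le_of_not_ge hij)
      rwa [dist_comm, abs_sub_comm] at this
    obtain ⟨n, rfl⟩ := Nat.exists_eq_add_of_le hij
    obtain ⟨h1, h2⟩ := hf (m + i) n (by omega)
    have h3 : |(i : ℝ) - (i + n : ℕ)| = n := by
      push_cast
      rw [sub_add_cancel_left, abs_neg, Nat.abs_cast]
    rw [h3]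
    push_cast
    rw [← add_assoc]
    refine ⟨?_, h2⟩
    have : (1 / K₀) * n ≤ dist (f (m + i)) (f (m + i + n)) + C₀ := by linarith
    rwa [one_div, inv_mul_le_iff₀ hK0] at this
  have hbroken : ∀ (m : ℤ) (n : ℕ), (n : ℝ) ≤ dist (f m) (f (m + n * M)) := by
    intro m n
    have := hY.le_dist_of_broken ha (x := fun i : ℕ => f (m + i * M)) ?_ ?_ n
    · simpa using this
    · intro i
      have := hmorse Y hY hg _ _ (hwin (m + i * M)) M (by omega)
      convert this using 2 <;> push_cast <;> ring_nf
    · intro i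
      have := (hf (m + i * M) M (by omega)).1
      have h2 : 2 * a + 2 * δ + 1 + C₀ ≤ 1 / K₀ * M := by
        rwa [one_div, le_inv_mul_iff₀ hK0]
      rw [show m + ((i + 1 : ℕ) : ℤ) * M = m + i * M + M by push_cast; ring]
      linarith
  have hglobal : ∀ (m : ℤ) (n : ℕ), (1 / max (M : ℝ) (K₀ + C₀)) * n - (K₀ * M + C₀ + 1) ≤
      dist (f m) (f (m + n)) ∧
      dist (f m) (f (m + n)) ≤ max (M : ℝ) (K₀ + C₀) * n + (K₀ * M + C₀ + 1) := by
    intro m n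
    constructor
    · have h1 := hbroken m (n / M)
      have hr : n % M ≤ 2 * M := (Nat.mod_lt _ hMpos).le.trans (by omega)
      have h2 := (hf (m + (n / M : ℕ) * M) (n % M) hr).2
      have e : (n : ℤ) = (n / M : ℕ) * M + (n % M : ℕ) := by
        exact_mod_cast (Nat.div_add_mod' n M).symm
      rw [add_assoc, ← e] at h2
      have h3 := dist_triangle_right (f m) (f (m + (n / M : ℕ) * M)) (f (m + n))
      have h4 : K₀ * ((n % M : ℕ) : ℝ) ≤ K₀ * M := by
        gcongr
        exact (Nat.mod_lt _ hMpos).le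
      have h5 : (1 / max (M : ℝ) (K₀ + C₀)) * n ≤ (1 / M : ℝ) * n := by
        gcongr
        exact le_max_left _ _
      have h6 : (1 / M : ℝ) * n ≤ (n / M : ℕ) + 1 := by
        have e' : (n : ℝ) = (n / M : ℕ) * M + (n % M : ℕ) := by exact_mod_cast e
        have : ((n % M : ℕ) : ℝ) ≤ M := by exact_mod_cast (Nat.mod_lt _ hMpos).le
        rw [one_div, inv_mul_le_iff₀ (by linarith)]
        nlinarith
      linarith
    · have h1 := dist_le_mul_of_steps hstep m n
      have h2 : (K₀ + C₀) * n ≤ max (M : ℝ) (K₀ + C₀) * n := by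
        gcongr
        exact le_max_right _ _
      have : 0 ≤ K₀ * M + C₀ + 1 := by positivity
      linarith
  intro m k
  wlog hmk : m ≤ k generalizing m k
  · rw [dist_comm m, dist_comm (f m)]
    exact this k m (le_of_not_ge hmk)
  obtain ⟨n, rfl⟩ := Int.le.dest hmk
  have : dist m (m + n) = n := by simp
  rw [this]
  exact hglobal m n

/-! ### Word metrics: Lipschitz maps, finite balls, discrete geodesics. -/

section WordMetric

variable {Γ : Type u} [Group Γ]

theorem Cayley.dist_def (S : FinGenSet Γ) (g h : Cayley S) :
    dist g h = (S.graph.dist (show Γ from g) (show Γ from h) : ℝ) := rfl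

/-- The identity of `Γ`, seen as a map onto the vertices of the Cayley graph. -/
def FinGenSet.toCayley (S : FinGenSet Γ) (g : Γ) : Cayley S := g

theorem FinGenSet.dist_toCayley_mul_left (S : FinGenSet Γ) (a g h : Γ) :
    dist (S.toCayley (a * g)) (S.toCayley (a * h)) = dist (S.toCayley g) (S.toCayley h) :=
  Cayley.dist_smul S a g h

/-- A map on `Γ` is Lipschitz for the word metric if the group acts by isometries of the induced
pseudo-distance. -/
theorem FinGenSet.exists_lipschitz (S : FinGenSet Γ) {Y : Type v} [MetricSpace Y] (u : Γ → Y)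
    (hu : ∀ a g h, dist (u (a * g)) (u (a * h)) = dist (u g) (u h)) :
    ∃ c : ℝ, 1 ≤ c ∧ ∀ g h, dist (u g) (u h) ≤ c * dist (S.toCayley g) (S.toCayley h) := by
  have hsum : ∀ s ∈ S.gens, dist (u 1) (u s) ≤ 1 + ∑ s ∈ S.gens, dist (u 1) (u s) := fun s hs =>
    (Finset.single_le_sum (f := fun s => dist (u 1) (u s)) (fun _ _ => dist_nonneg) hs).trans
      (by linarith)
  have hpos : 0 ≤ ∑ s ∈ S.gens, dist (u 1) (u s) := Finset.sum_nonneg fun _ _ => dist_nonneg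
  set c := 1 + ∑ s ∈ S.gens, dist (u 1) (u s) with hc
  refine ⟨c, by linarith, fun g h => ?_⟩
  obtain ⟨p, hp⟩ := S.connected.exists_walk_length_eq_dist g h
  have hedge : ∀ a b, S.graph.Adj a b → dist (u a) (u b) ≤ c := by
    have key : ∀ a b, a⁻¹ * b ∈ S.gens → dist (u a) (u b) ≤ c := fun a b hab => by
      have := hu a 1 (a⁻¹ * b)
      rw [mul_one, mul_inv_cancel_left] at this
      rw [this]
      exact hsum _ hab
    intro a b hab
    obtain ⟨-, h | h⟩ := (SimpleGraph.mulCayley_adj _ _ _).1 hab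
    · exact key a b h
    · rw [dist_comm]
      exact key b a h
  have hwalk : ∀ (a b : Γ) (p : S.graph.Walk a b), dist (u a) (u b) ≤ c * p.length := by
    intro a b p
    induction p with
    | nil => simp
    | cons hab p ih =>
      rw [SimpleGraph.Walk.length_cons]
      push_cast
      have h1 := hedge _ _ hab
      have h2 := dist_triangle (u _) (u _) (u _) |>.trans (add_le_add h1 ih)
      linarith
  exact (hwalk g h p).trans_eq (by rw [hp]; rfl)

-- A walk of length `n` from `g` to `h` writes `g⁻¹ * h` as a product of `n` elements of `T`; since
-- `1 ∈ T`, the single power `T ^ ⌊r⌋₊` contains all the shorter ones.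
open Pointwise in
theorem FinGenSet.finite_ball (S : FinGenSet Γ) (g : Γ) (r : ℝ) :
    {h : Γ | dist (S.toCayley g) (S.toCayley h) ≤ r}.Finite := by
  set T : Set Γ := (S.gens : Set Γ) ∪ (S.gens : Set Γ)⁻¹ ∪ {1} with hT
  have hTfin : T.Finite := ((S.gens.finite_toSet).union S.gens.finite_toSet.inv).union
    (finite_singleton 1)
  have hpow : ∀ n : ℕ, (T ^ n).Finite := fun n => by
    induction n with
    | zero => simp
    | succ n ih => rw [pow_succ]; exact ih.mul hTfin
  have hwalk : ∀ (a b : Γ) (p : S.graph.Walk a b), a⁻¹ * b ∈ T ^ p.length := by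
    intro a b p
    induction p with
    | nil => simp
    | @cons a b c hab p ih =>
      rw [SimpleGraph.Walk.length_cons, pow_succ']
      refine ⟨a⁻¹ * b, ?_, b⁻¹ * c, ih, by group⟩
      obtain ⟨-, h | h⟩ := (SimpleGraph.mulCayley_adj _ _ _).1 hab
      · exact Or.inl (Or.inl h)
      · exact Or.inl (Or.inr (by simpa using h))
  refine Finite.subset ((hpow ⌊r⌋₊).image (g * ·)) fun h hh => ?_
  obtain ⟨p, hp⟩ := S.connected.exists_walk_length_eq_dist g h
  refine ⟨g⁻¹ * h, ?_, by simp⟩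
  have hle : p.length ≤ ⌊r⌋₊ := by
    refine Nat.le_floor ?_
    rw [hp]
    exact hh
  exact pow_subset_pow_right (Or.inr rfl : (1 : Γ) ∈ T) hle (hwalk g h p)

/-- Any two vertices of the Cayley graph are joined by a discrete geodesic. -/
theorem FinGenSet.exists_geodesic (S : FinGenSet Γ) (x y : Cayley S) :
    ∃ (g : ℕ → Cayley S) (N : ℕ), g 0 = x ∧ g N = y ∧ dist x y = N ∧
      ∀ i ≤ N, ∀ j ≤ N, dist (g i) (g j) = |(i : ℝ) - j| := by
  obtain ⟨p, hp⟩ := S.connected.exists_walk_length_eq_dist x y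
  set g : ℕ → Cayley S := fun i => p.getVert i with hg
  have h0 : g 0 = x := p.getVert_zero
  have hN : g p.length = y := p.getVert_length
  have hd : dist x y = p.length := by rw [hp]; rfl
  have hstep : ∀ i n, dist (g i) (g (i + n)) ≤ n := by
    intro i n
    induction n with
    | zero => simp
    | succ n ih =>
      have h1 : dist (g (i + n)) (g (i + n + 1)) ≤ 1 := by
        rcases lt_or_ge (i + n) p.length with h | h
        · have := SimpleGraph.dist_eq_one_iff_adj.2 (p.adj_getVert_succ h)
          rw [Cayley.dist_def]
          exact_mod_cast this.le
        · have : g (i + n) = g (i + n + 1) := by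
            simp only [hg]
            rw [p.getVert_of_length_le h, p.getVert_of_length_le (h.trans (Nat.le_succ _))]
          rw [this, dist_self]
          exact zero_le_one
      have h2 := dist_triangle (g i) (g (i + n)) (g (i + n + 1))
      push_cast
      rw [← add_assoc]
      linarith
  refine ⟨g, p.length, h0, hN, hd, fun i hi j hj => ?_⟩
  wlog hij : i ≤ j generalizing i j
  · rw [dist_comm, abs_sub_comm]
    exact this j hj i hi (le_of_not_ge hij)
  obtain ⟨n, rfl⟩ := Nat.exists_eq_add_of_le hij
  have e : |(i : ℝ) - (i + n : ℕ)| = n := by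
    push_cast
    rw [sub_add_cancel_left, abs_neg, Nat.abs_cast]
  rw [e]
  -- A shortcut between two vertices would shorten the whole walk, which is minimal.
  refine le_antisymm (hstep i n) ?_
  obtain ⟨k, hk⟩ := Nat.exists_eq_add_of_le hj
  have h1 := hstep 0 i
  have h2 := hstep (i + n) k
  have h3 := dist_triangle4 (g 0) (g i) (g (i + n)) (g p.length)
  rw [zero_add] at h1
  rw [← hk, hN] at h2
  rw [h0, hN, hd] at h3
  rw [h0] at h1
  have h4 : (p.length : ℝ) = i + n + k := by exact_mod_cast hk
  linarith

/-- The error `1` absorbs the rounding of `t`, so the Morse lemma applies both to `X` and to vertex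
sets of Cayley graphs. -/
theorem FinGenSet.isRoughlyGeodesic (S : FinGenSet Γ) : IsRoughlyGeodesic (Cayley S) := by
  intro x y t ht
  obtain ⟨g, N, h0, hN, hd, hg⟩ := S.exists_geodesic x y
  have hf : (⌊t⌋₊ : ℝ) ≤ t := Nat.floor_le ht.1
  have hf' : t < ⌊t⌋₊ + 1 := Nat.lt_floor_add_one t
  have hle : ⌊t⌋₊ ≤ N := by
    have := ht.2
    rw [hd] at this
    exact_mod_cast hf.trans this
  have hle' : (⌊t⌋₊ : ℝ) ≤ N := by exact_mod_cast hle
  refine ⟨g ⌊t⌋₊, ?_, ?_⟩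
  · rw [← h0, hg 0 (Nat.zero_le _) _ hle, Nat.cast_zero, zero_sub, abs_neg, Nat.abs_cast]
    linarith
  · rw [← hN, hg _ hle N le_rfl, hN, hd, abs_sub_comm, abs_of_nonneg (sub_nonneg.2 hle')]
    linarith

end WordMetric

/-! ### Lines connecting the fixed points of an element. -/

section Lines

variable {Γ : Type u} [Group Γ]

theorem boundaryAct_mk_eq_iff (S : FinGenSet Γ) (a : Γ) (r : GeodesicRay S) :
    boundaryAct S a (Quotient.mk (raySetoid S) r) = Quotient.mk (raySetoid S) r ↔
      ∃ D : ℝ, ∀ n, dist (a • r.1 n) (r.1 n) ≤ D :=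
  Quotient.eq (r := raySetoid S)

/-- The lines in `L_S(a)` are the lines which `a` moves by a bounded amount. -/
theorem mem_axisGeodesics_iff (S : FinGenSet Γ) (a : Γ) (l : GeodesicLine S) :
    l ∈ axisGeodesics S a ↔ ∃ D : ℝ, ∀ n, dist (a • l.1 n) (l.1 n) ≤ D := by
  constructor
  · rintro ⟨h1, h2, -⟩
    obtain ⟨D₁, h1⟩ := (boundaryAct_mk_eq_iff S a _).1 h1
    obtain ⟨D₂, h2⟩ := (boundaryAct_mk_eq_iff S a _).1 h2
    refine ⟨max D₁ D₂, fun n => ?_⟩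
    obtain ⟨k, rfl | rfl⟩ := n.eq_nat_or_neg
    · exact (h2 k).trans (le_max_right _ _)
    · exact (h1 k).trans (le_max_left _ _)
  · rintro ⟨D, hD⟩
    refine ⟨(boundaryAct_mk_eq_iff S a _).2 ⟨D, fun n => hD _⟩,
      (boundaryAct_mk_eq_iff S a _).2 ⟨D, fun n => hD _⟩, fun h => ?_⟩
    obtain ⟨E, hE⟩ : ∃ E : ℝ, ∀ n : ℕ, dist (l.1 (-(n : ℤ))) (l.1 n) ≤ E :=
      Quotient.eq (r := raySetoid S).1 h
    obtain ⟨n, hn⟩ := exists_nat_gt E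
    have h1 := hE n
    rw [l.2.dist_eq, Int.dist_eq] at h1
    push_cast at h1
    rw [abs_sub_comm, sub_neg_eq_add, abs_of_nonneg (by positivity)] at h1
    have : (0 : ℝ) ≤ n := n.cast_nonneg
    linarith

end Lines

/-! ### Bi-Lipschitz paths follow bi-infinite geodesics. -/

section Shadowing

variable {Γ : Type u} [Group Γ]

/-- A bi-Lipschitz path in a hyperbolic group is shadowed, on each finite window, by geodesics of
any Cayley graph. -/
theorem exists_geodesic_shadowing_window (hΓ : IsHyperbolicGroup Γ) (S : FinGenSet Γ) {c : ℝ}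
    (hc : 1 ≤ c) : ∃ D : ℝ, 0 ≤ D ∧ ∀ h : ℤ → Cayley S,
      (∀ m n : ℤ, |(m : ℝ) - n| ≤ c * dist (h m) (h n) ∧ dist (h m) (h n) ≤ c * |(m : ℝ) - n|) →
      ∀ n : ℕ, ∃ (g : ℕ → Cayley S) (N : ℕ),
        (∀ i ≤ N, ∀ j ≤ N, dist (g i) (g j) = |(i : ℝ) - j|) ∧ g 0 = h (-n) ∧ g N = h n ∧
        (∀ m : ℤ, |m| ≤ n → ∃ i ≤ N, dist (h m) (g i) ≤ D) ∧
        (∀ i ≤ N, ∃ m : ℤ, |m| ≤ n ∧ dist (g i) (h m) ≤ D) := by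
  obtain ⟨S₀, δ, hδ⟩ := hΓ
  obtain ⟨c₁, hc₁, h₁⟩ := S.exists_lipschitz S₀.toCayley (S₀.dist_toCayley_mul_left)
  obtain ⟨c₂, hc₂, h₂⟩ := S₀.exists_lipschitz S.toCayley (S.dist_toCayley_mul_left)
  have hcc : c ≤ c * c₁ := le_mul_of_one_le_right (by linarith) hc₁
  have hK : c * c₁ ≤ c * c₁ * c₂ := le_mul_of_one_le_right (by positivity) hc₂
  have hK' : c * c₂ ≤ c * c₁ * c₂ := by gcongr
  have hK₁ : c₁ ≤ c * c₁ := le_mul_of_one_le_left (by linarith) hc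
  have hK₂ : c₂ ≤ c * c₂ := le_mul_of_one_le_left (by linarith) hc
  set K := c * c₁ * c₂ with hKdef
  have hK1 : 1 ≤ K := by linarith
  obtain ⟨a, ha, hmorse⟩ :=
    exists_bound_gromovProduct_quasiGeodesic.{u} δ K 0 hδ.1 hK1 le_rfl
  have hδ0 := hδ.1
  refine ⟨c₂ * (4 * a + K + 2 * δ), by positivity, fun h hh n => ?_⟩
  obtain ⟨g, N, hg0, hgN, -, hg⟩ := S.exists_geodesic (h (-n)) (h n)
  -- Only the Cayley graph of `S₀` is known to be hyperbolic. There the path and the `S`-geodesic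
  -- are both quasi-geodesics with the same endpoints, hence mutually close; `c₂` converts back to
  -- `S`.
  set F : ℕ → Cayley S₀ := fun i => S₀.toCayley (h (i - n)) with hF
  set G : ℕ → Cayley S₀ := fun i => S₀.toCayley (g i) with hG
  have hFqi : IsQuasiGeodesicTo K 0 F (2 * n) := by
    intro i _ j _
    obtain ⟨e₁, e₂⟩ := hh (i - n) (j - n)
    have e₃ : dist (F i) (F j) ≤ c₁ * dist (h (i - n)) (h (j - n)) := h₁ _ _
    have e₄ : dist (h (i - n)) (h (j - n)) ≤ c₂ * dist (F i) (F j) := h₂ _ _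
    have e₅ : |(((i - n : ℤ)) : ℝ) - ((j - n : ℤ) : ℝ)| = |(i : ℝ) - j| := by
      push_cast; congr 1; ring
    rw [e₅] at e₁ e₂
    have hd : 0 ≤ dist (F i) (F j) := dist_nonneg
    constructor
    · calc |(i : ℝ) - j| ≤ c * (c₂ * dist (F i) (F j)) := e₁.trans (by gcongr)
        _ = c * c₂ * dist (F i) (F j) := by ring
        _ ≤ K * (dist (F i) (F j) + 0) := by rw [add_zero]; gcongr
    · calc dist (F i) (F j) ≤ c₁ * (c * |(i : ℝ) - j|) := e₃.trans (by gcongr)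
        _ = c * c₁ * |(i : ℝ) - j| := by ring
        _ ≤ K * |(i : ℝ) - j| + 0 := by rw [add_zero]; gcongr
  have hGqi : IsQuasiGeodesicTo K 0 G N := by
    intro i hi j hj
    have e₁ := hg i hi j hj
    have e₃ : dist (G i) (G j) ≤ c₁ * dist (g i) (g j) := h₁ _ _
    have e₄ : dist (g i) (g j) ≤ c₂ * dist (G i) (G j) := h₂ _ _
    rw [e₁] at e₃ e₄
    have hd : 0 ≤ dist (G i) (G j) := dist_nonneg
    constructor
    · refine e₄.trans ?_
      rw [add_zero]
      gcongr
      linarith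
    · refine e₃.trans ?_
      rw [add_zero]
      gcongr
      linarith
  have hFg := hmorse _ hδ S₀.isRoughlyGeodesic F _ hFqi
  have hGg := hmorse _ hδ S₀.isRoughlyGeodesic G _ hGqi
  have e0 : F 0 = G 0 := by simp only [hF, hG, hg0]; congr 2; simp
  have eN : F (2 * n) = G N := by
    simp only [hF, hG, hgN]; congr 2; push_cast; ring
  have hFstep : ∀ j < 2 * n, dist (F j) (F (j + 1)) ≤ K := fun j hj => by
    simpa using hFqi.dist_succ_le hj
  have hGstep : ∀ j < N, dist (G j) (G (j + 1)) ≤ K := fun j hj => by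
    simpa using hGqi.dist_succ_le hj
  refine ⟨g, N, hg, hg0, hgN, fun m hm => ?_, fun i hi => ?_⟩
  · obtain ⟨hm1, hm2⟩ := abs_le.1 hm
    obtain ⟨k, hk⟩ := Int.eq_ofNat_of_zero_le (show 0 ≤ m + n by omega)
    have hkm : ((k : ℕ) : ℤ) - n = m := by omega
    have := hFg k (by omega)
    rw [e0, eN] at this
    obtain ⟨i, hi, hd⟩ := hδ.exists_dist_le_of_gromovProduct_le hGg hGstep (by linarith) ha this
    refine ⟨i, hi, ?_⟩
    have e : dist (h m) (g i) ≤ c₂ * dist (S₀.toCayley (h m)) (S₀.toCayley (g i)) := h₂ _ _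
    simp only [hF, hG, hkm] at hd
    exact e.trans (by gcongr)
  · have := hGg i hi
    rw [← e0, ← eN] at this
    obtain ⟨k, hk, hd⟩ := hδ.exists_dist_le_of_gromovProduct_le hFg hFstep (by linarith) ha this
    refine ⟨k - n, abs_le.2 ⟨by omega, by omega⟩, ?_⟩
    have e : dist (g i) (h (k - n)) ≤ c₂ * dist (S₀.toCayley (g i)) (S₀.toCayley (h (k - n))) :=
      h₂ _ _
    exact e.trans (by gcongr)

/-- Pigeonhole for ultrafilters; it plays the role of a diagonal extraction of subsequences. -/
theorem Ultrafilter.exists_eventually_eq {ι α : Type*} (U : Ultrafilter ι) {F : ι → α} {s : Set α}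
    (hs : s.Finite) (hF : ∀ᶠ i in U, F i ∈ s) : ∃ v, ∀ᶠ i in U, F i = v := by
  have : (⋃ v ∈ s, {i | F i = v}) ∈ U := by
    filter_upwards [hF] with i hi
    simpa using hi
  obtain ⟨v, -, hv⟩ := (Ultrafilter.finite_biUnion_mem_iff hs).1 this
  exact ⟨v, hv⟩

/-- A bi-Lipschitz path in a hyperbolic group is at bounded Hausdorff distance from a bi-infinite
geodesic of any Cayley graph. -/
theorem exists_geodesicLine_shadowing (hΓ : IsHyperbolicGroup Γ) (S : FinGenSet Γ) {c : ℝ}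
    (hc : 1 ≤ c) : ∃ D : ℝ, 0 ≤ D ∧ ∀ h : ℤ → Cayley S,
      (∀ m n : ℤ, |(m : ℝ) - n| ≤ c * dist (h m) (h n) ∧ dist (h m) (h n) ≤ c * |(m : ℝ) - n|) →
      ∃ l : GeodesicLine S, (∀ m, ∃ k, dist (h m) (l.1 k) ≤ D) ∧
        (∀ k, ∃ m, dist (l.1 k) (h m) ≤ D) := by
  obtain ⟨D, hD, hwin⟩ := exists_geodesic_shadowing_window hΓ S hc
  refine ⟨D, hD, fun h hh => ?_⟩
  choose g N hg hg0 hgN hgh hhg using hwin h hh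
  choose j hjN hj using fun n => hgh n 0 (by simp)
  set U : Ultrafilter ℕ := Filter.hyperfilter ℕ with hU
  have hev : ∀ p : ℕ → Prop, (∀ᶠ n in Filter.atTop, p n) → ∀ᶠ n in U, p n := fun p hp =>
    Nat.hyperfilter_le_atTop hp
  -- The segments are recentred at a point within `D` of `h 0`. The truncation by `toNat` is
  -- harmless, as each `k` is a valid index for `U`-almost all `n`.
  set G : ℕ → ℤ → Cayley S := fun n k => g n (j n + k).toNat with hG
  -- `j n` tends to infinity away from both ends
  have hj1 : ∀ n : ℕ, (n : ℝ) ≤ c * (j n + D) := fun n => by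
    have e₁ := (hh (-n) 0).1
    have e₂ := hg n 0 (Nat.zero_le _) (j n) (hjN n)
    have e₃ := dist_triangle_right (h (-n)) (h 0) (g n (j n))
    rw [hg0] at e₂
    push_cast at e₁ e₂
    rw [sub_zero, abs_neg, Nat.abs_cast] at e₁
    rw [zero_sub, abs_neg, Nat.abs_cast] at e₂
    have e₄ := hj n
    refine e₁.trans ?_
    gcongr
    linarith
  have hj2 : ∀ n : ℕ, (n : ℝ) ≤ c * (N n - j n + D) := fun n => by
    have e₁ := (hh n 0).1
    have e₂ := hg n (N n) le_rfl (j n) (hjN n)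
    have e₃ := dist_triangle_right (h n) (h 0) (g n (j n))
    have e₅ : (j n : ℝ) ≤ N n := by exact_mod_cast hjN n
    rw [hgN, abs_of_nonneg (by linarith)] at e₂
    push_cast at e₁
    rw [sub_zero, Nat.abs_cast] at e₁
    have e₄ := hj n
    refine e₁.trans ?_
    gcongr
    linarith
  have hvalid : ∀ k : ℤ, ∀ᶠ n in U, 0 ≤ j n + k ∧ j n + k ≤ N n := by
    intro k
    refine hev _ ?_
    obtain ⟨n₀, hn₀⟩ := exists_nat_gt (c * (|(k : ℝ)| + D))
    filter_upwards [Filter.eventually_ge_atTop n₀] with n hn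
    have hn' : (n₀ : ℝ) ≤ n := by exact_mod_cast hn
    have hc0 : 0 < c := by linarith
    have e₁ := lt_of_mul_lt_mul_left (hn₀.trans_le (hn'.trans (hj1 n))) hc0.le
    have e₂ := lt_of_mul_lt_mul_left (hn₀.trans_le (hn'.trans (hj2 n))) hc0.le
    have e₃ := neg_abs_le (k : ℝ)
    have e₄ := le_abs_self (k : ℝ)
    constructor
    · have : (0 : ℝ) ≤ j n + k := by linarith
      exact_mod_cast this
    · have : (j n : ℝ) + k ≤ N n := by linarith
      exact_mod_cast this
  have hGdist : ∀ (n : ℕ) (k k' : ℤ), (0 ≤ j n + k ∧ j n + k ≤ N n) → (0 ≤ j n + k' ∧ j n + k' ≤ N n) →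
      dist (G n k) (G n k') = |(k : ℝ) - k'| := by
    intro n k k' hk hk'
    have e := hg n (j n + k).toNat (by omega) (j n + k').toNat (by omega)
    have e₁ : (((j n + k).toNat : ℕ) : ℝ) = j n + k := by
      exact_mod_cast Int.toNat_of_nonneg hk.1
    have e₂ : (((j n + k').toNat : ℕ) : ℝ) = j n + k' := by
      exact_mod_cast Int.toNat_of_nonneg hk'.1
    rw [e₁, e₂, add_sub_add_left_eq_sub] at e
    exact e
  have hG0 : ∀ n, G n 0 = g n (j n) := fun n => by simp [hG]
  have hvalid0 : ∀ n, 0 ≤ (j n : ℤ) + 0 ∧ (j n : ℤ) + 0 ≤ N n := fun n =>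
    ⟨by omega, by have := hjN n; omega⟩
  have hlim : ∀ k, ∃ v : Cayley S, ∀ᶠ n in U, G n k = v := by
    intro k
    refine Ultrafilter.exists_eventually_eq U (S.finite_ball (h 0) (D + |(k : ℝ)|)) ?_
    filter_upwards [hvalid k] with n hn
    change dist (h 0) (G n k) ≤ _
    have e := hGdist n 0 k (hvalid0 n) hn
    rw [hG0, Int.cast_zero, zero_sub, abs_neg] at e
    have := dist_triangle (h 0) (g n (j n)) (G n k)
    have := hj n
    linarith
  choose l hl using hlim
  have hiso : Isometry l := by
    refine Isometry.of_dist_eq fun k k' => ?_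
    obtain ⟨n, hk, hk', e, e'⟩ :=
      ((hvalid k).and ((hvalid k').and ((hl k).and (hl k')))).exists
    rw [← e, ← e', hGdist n k k' hk hk', Int.dist_eq]
  have hIcc : ∀ (R : ℝ), {k : ℤ | |(k : ℝ)| ≤ R}.Finite := fun R =>
    (Set.finite_Icc (-⌈R⌉) ⌈R⌉).subset fun k hk => by
      have e : |(k : ℝ)| ≤ ⌈R⌉ := (show |(k : ℝ)| ≤ R from hk).trans (Int.le_ceil R)
      exact abs_le.1 (by exact_mod_cast e)
  refine ⟨⟨l, hiso⟩, fun m => ?_, fun k => ?_⟩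
  · have hsel : ∀ n : ℕ, ∃ k : ℤ, |m| ≤ n → (0 ≤ j n + k ∧ j n + k ≤ N n) ∧
        dist (h m) (G n k) ≤ D := fun n => by
      by_cases hm : |m| ≤ n
      · obtain ⟨i, hi, hd⟩ := hgh n m hm
        refine ⟨i - j n, fun _ => ⟨⟨by omega, by omega⟩, ?_⟩⟩
        simpa [hG] using hd
      · exact ⟨0, fun h => absurd h hm⟩
    choose κ hκ using hsel
    have hbig : ∀ᶠ n : ℕ in U, |m| ≤ n := hev _ (by
      filter_upwards [Filter.eventually_ge_atTop m.natAbs] with n hn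
      rw [Int.abs_eq_natAbs]
      exact_mod_cast hn)
    -- The index of a point close to `h m` is bounded independently of `n`, so it too can be made
    -- constant along `U`.
    obtain ⟨k, hk⟩ := Ultrafilter.exists_eventually_eq U (F := κ)
      (hIcc (2 * D + c * |(m : ℝ)|)) (by
        filter_upwards [hbig] with n hn
        obtain ⟨hv, hd⟩ := hκ n hn
        have e := hGdist n (κ n) 0 hv (hvalid0 n)
        rw [hG0, Int.cast_zero, sub_zero] at e
        change |(κ n : ℝ)| ≤ _
        have e₁ := dist_triangle4 (G n (κ n)) (h m) (h 0) (g n (j n))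
        have e₂ := (hh m 0).2
        rw [Int.cast_zero, sub_zero] at e₂
        rw [dist_comm (G n (κ n)) (h m)] at e₁
        have := hj n
        linarith)
    obtain ⟨n, hn, rfl, e⟩ := (hbig.and (hk.and (hl k))).exists
    exact ⟨κ n, (congrArg (dist (h m)) e).symm.trans_le (hκ n hn).2⟩
  · have hsel : ∀ n : ℕ, ∃ m : ℤ, (0 ≤ j n + k ∧ j n + k ≤ N n) →
        dist (G n k) (h m) ≤ D := fun n => by
      by_cases hv : 0 ≤ j n + k ∧ j n + k ≤ N n
      · obtain ⟨m, -, hd⟩ := hhg n (j n + k).toNat (by omega)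
        exact ⟨m, fun _ => hd⟩
      · exact ⟨0, fun h => absurd h hv⟩
    choose μ hμ using hsel
    obtain ⟨n, hn, e⟩ := ((hvalid k).and (hl k)).exists
    exact ⟨μ n, (congrArg (dist · (h (μ n))) e).symm.trans_le (hμ n hn)⟩

end Shadowing

/-! ### Invariance under automorphisms. -/

section OutInvariance

variable {Γ : Type u} [Group Γ] {X : Type v} [MetricSpace X]

theorem Rep.dist_mul_left (ρ : Rep Γ X) (x : X) (a g h : Γ) :
    dist (ρ (a * g) x) (ρ (a * h) x) = dist (ρ g x) (ρ h x) := by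
  rw [map_mul, map_mul]
  exact (ρ a).dist_eq _ _

/-- Stability is preserved by precomposition with automorphisms. -/
theorem IsStable.comp_mulAut (hΓ : IsHyperbolicGroup Γ) {S : FinGenSet Γ} {A : Set Γ}
    (hA : IsAutInvariant A) {ρ : Rep Γ X} (hρ : IsStable S A ρ) (φ : MulAut Γ) :
    IsStable S A (ρ.comp φ.toMonoidHom) := by
  obtain ⟨K, C, hK, hC, x, hx⟩ := hρ
  obtain ⟨c₁, hc₁, h₁⟩ := S.exists_lipschitz (fun g => S.toCayley (φ g)) (fun a g h => by
    rw [map_mul, map_mul]; exact S.dist_toCayley_mul_left _ _ _)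
  obtain ⟨c₂, hc₂, h₂⟩ := S.exists_lipschitz (fun g => S.toCayley (φ⁻¹ g)) (fun a g h => by
    rw [map_mul, map_mul]; exact S.dist_toCayley_mul_left _ _ _)
  have h₂' : ∀ g h : Γ, dist (S.toCayley g) (S.toCayley h) ≤
      c₂ * dist (S.toCayley (φ g)) (S.toCayley (φ h)) := fun g h => by
    simpa using h₂ (φ g) (φ h)
  obtain ⟨c₃, hc₃, h₃⟩ := S.exists_lipschitz (fun g => ρ g x) (ρ.dist_mul_left x)
  have hc : 1 ≤ c₁ * c₂ := one_le_mul_of_one_le_of_one_le hc₁ hc₂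
  have hle₁ : c₁ ≤ c₁ * c₂ := le_mul_of_one_le_right (by linarith) hc₂
  have hle₂ : c₂ ≤ c₁ * c₂ := le_mul_of_one_le_left (by linarith) hc₁
  set c := c₁ * c₂ with hcdef
  obtain ⟨D, hD, hshadow⟩ := exists_geodesicLine_shadowing hΓ S hc
  -- Passing from `φ(l)` to the shadowing line costs `D` at each end in the Cayley graph and `c₃ *
  -- D` at each end in `X`.
  refine ⟨K * c * c₃, C + 2 * (c₃ * D) + 2 * D, ?_, by positivity, x, ?_⟩
  · exact one_le_mul_of_one_le_of_one_le (one_le_mul_of_one_le_of_one_le hK hc) hc₃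
  rintro l ⟨a, haA, hfin, hl⟩
  obtain ⟨E, hE⟩ := (mem_axisGeodesics_iff S a l).1 hl
  set h : ℤ → Cayley S := fun n => S.toCayley (φ (l.1 n)) with hh
  have hbi : ∀ m n : ℤ, |(m : ℝ) - n| ≤ c * dist (h m) (h n) ∧
      dist (h m) (h n) ≤ c * |(m : ℝ) - n| := by
    intro m n
    have e₁ : dist (h m) (h n) ≤ c₁ * dist (l.1 m) (l.1 n) := h₁ _ _
    have e₂ : dist (l.1 m) (l.1 n) ≤ c₂ * dist (h m) (h n) := h₂' _ _
    rw [l.2.dist_eq, Int.dist_eq] at e₁ e₂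
    exact ⟨e₂.trans (by gcongr), e₁.trans (by gcongr)⟩
  obtain ⟨l', hl₁, hl₂⟩ := hshadow h hbi
  -- As `a` moves `l` boundedly, `φ a` moves `φ(l)` boundedly, hence also the nearby line `l'`.
  have hmem : l' ∈ axisGeodesicsOf S A := by
    refine ⟨φ a, by rw [← hA φ]; exact ⟨a, haA, rfl⟩,
      fun hf => hfin (by simpa using φ.symm.toMonoidHom.isOfFinOrder hf), (mem_axisGeodesics_iff S _ l').2
        ⟨D + c₁ * E + D, fun k => ?_⟩⟩
    obtain ⟨m, hm⟩ := hl₂ k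
    have e₁ : dist (φ a • l'.1 k) (φ a • h m) ≤ D := by rwa [Cayley.dist_smul]
    have e₂ : dist (φ a • h m) (h m) ≤ c₁ * E := by
      have e : dist (S.toCayley (φ (a * (show Γ from l.1 m)))) (S.toCayley (φ (l.1 m))) ≤
        c₁ * dist (a • l.1 m) (l.1 m) := h₁ _ _
      rw [map_mul] at e
      exact e.trans (by gcongr; exact hE m)
    have e₃ := dist_triangle4 (φ a • l'.1 k) (φ a • h m) (h m) (l'.1 k)
    rw [dist_comm (h m) (l'.1 k)] at e₃
    linarith
  have hqi := hx l' hmem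
  choose κ hκ using hl₁
  intro m n
  change _ ≤ dist (ρ (h m) x) (ρ (h n) x) ∧ dist (ρ (h m) x) (ρ (h n) x) ≤ _
  have hclose : ∀ m, dist (ρ (h m) x) (ρ (l'.1 (κ m)) x) ≤ c₃ * D := fun m =>
    (h₃ _ _).trans (by gcongr; exact hκ m)
  have e₀ : dist (ρ (h m) x) (ρ (h n) x) ≤ c₃ * dist (h m) (h n) := h₃ _ _
  obtain ⟨e₁, e₂⟩ := hbi m n
  have e₃ : 1 / K * dist (κ m) (κ n) - C ≤ dist (ρ (l'.1 (κ m)) x) (ρ (l'.1 (κ n)) x) :=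
    (hqi (κ m) (κ n)).1
  have e₄ : dist (l'.1 (κ m)) (l'.1 (κ n)) = dist (κ m) (κ n) := l'.2.dist_eq _ _
  rw [← Int.dist_eq] at e₁ e₂
  have hd : 0 ≤ dist m n := dist_nonneg
  have hKpos : 0 < K := by linarith
  constructor
  · have e₅ := dist_triangle4 (ρ (l'.1 (κ m)) x) (ρ (h m) x) (ρ (h n) x) (ρ (l'.1 (κ n)) x)
    rw [dist_comm (ρ (l'.1 (κ m)) x) (ρ (h m) x)] at e₅
    have e₆ := dist_triangle4 (h m) (l'.1 (κ m)) (l'.1 (κ n)) (h n)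
    rw [dist_comm (l'.1 (κ n)) (h n)] at e₆
    have e₇ := hclose m
    have e₈ := hclose n
    have e₉ := hκ m
    have e₁₀ := hκ n
    have f₁ : 1 / (K * c * c₃) * dist m n ≤ 1 / K * dist (h m) (h n) := by
      have : 1 / (K * c * c₃) ≤ 1 / (K * c) := by
        apply one_div_le_one_div_of_le (by positivity)
        exact le_mul_of_one_le_right (by positivity) hc₃
      calc 1 / (K * c * c₃) * dist m n ≤ 1 / (K * c) * (c * dist (h m) (h n)) := by gcongr
        _ = 1 / K * dist (h m) (h n) := by field_simp
    have f₂ : 1 / K * dist (h m) (h n) ≤ 1 / K * dist (κ m) (κ n) + 2 * D := by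
      have g₁ : 1 / K * dist (h m) (h n) ≤ 1 / K * (dist (κ m) (κ n) + 2 * D) := by
        gcongr
        linarith
      have g₂ : 1 / K * (2 * D) ≤ 1 * (2 * D) := by
        gcongr
        rw [div_le_one hKpos]
        exact hK
      linarith
    linarith
  · have f₁ : c₃ * dist (h m) (h n) ≤ c₃ * (c * dist m n) := by gcongr
    have f₂ : 1 * (c₃ * (c * dist m n)) ≤ K * (c₃ * (c * dist m n)) := by gcongr
    have f₃ : 0 ≤ C + 2 * (c₃ * D) + 2 * D := by positivity
    linarith

end OutInvariance

/-! ### Quasi-convex representations are stable. -/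

section QuasiConvex

variable {X : Type v} [MetricSpace X]

/-- The compact-open topology is that of uniform convergence on compact sets. -/
theorem exists_isCompact_of_mem_nhds_one {V : Set (X ≃ᵢ X)} (hV : V ∈ 𝓝 (1 : X ≃ᵢ X)) :
    ∃ (K : Set X) (ε : ℝ), IsCompact K ∧ 0 < ε ∧
      ∀ g : X ≃ᵢ X, (∀ y ∈ K, dist y (g y) < ε) → g ∈ V := by
  rw [nhds_induced] at hV
  obtain ⟨t, ht, hV⟩ := hV
  obtain ⟨E, hE, ht⟩ := UniformSpace.mem_nhds_iff.1 ht
  obtain ⟨⟨K, ε⟩, ⟨hK, hε⟩, hE⟩ :=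
    (Metric.uniformity_basis_dist.compactConvergenceUniformity (α := X)).mem_iff.1 hE
  exact ⟨K, ε, hK, hε, fun g hg => hV (ht (hE fun y hy => hg y hy))⟩

/-- A discrete group of isometries of a proper metric space acts properly. -/
theorem finite_of_discrete [ProperSpace X] (H : Subgroup (X ≃ᵢ X)) [DiscreteTopology H] (x : X)
    (R : ℝ) : {h : X ≃ᵢ X | h ∈ H ∧ dist x (h x) ≤ R}.Finite := by
  obtain ⟨V, hV, hVH⟩ := (mem_nhds_subtype (H : Set (X ≃ᵢ X)) (1 : H) {1}).1
    ((isOpen_discrete _).mem_nhds rfl)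
  obtain ⟨K, ε, hK, hε, hKV⟩ := exists_isCompact_of_mem_nhds_one hV
  obtain ⟨t, -, htfin, ht⟩ := hK.finite_cover_balls (show 0 < ε / 4 by positivity)
  have := htfin.fintype
  obtain ⟨D, hD⟩ : ∃ D : ℝ, ∀ y : t, dist x y ≤ D := by
    obtain ⟨D, hD⟩ := (Set.finite_range fun y : t => dist x y).bddAbove
    exact ⟨D, fun y => hD ⟨y, rfl⟩⟩
  -- An isometry is recorded by its values on the finite net `t`; these lie in a compact ball of the
  -- proper space `t → X`. Absolute values keep the radius nonnegative.
  obtain ⟨s, -, hsfin, hs⟩ := (isCompact_closedBall (fun _ : t => x) (|R| + |D|)).finite_cover_balls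
    (show 0 < ε / 4 by positivity)
  have hcov : ∀ h : X ≃ᵢ X, ∃ p, dist x (h x) ≤ R →
      p ∈ s ∧ dist (fun y : t => h y) p < ε / 4 := by
    intro h
    by_cases hR : dist x (h x) ≤ R
    · have : (fun y : t => h y) ∈ Metric.closedBall (fun _ : t => x) (|R| + |D|) := by
        rw [Metric.mem_closedBall, dist_pi_le_iff (by positivity)]
        intro y
        have e₁ := dist_triangle_left (h y) x (h x)
        have e₂ := h.dist_eq x y
        have e₃ := hD y
        have e₄ := le_abs_self R
        have e₅ := le_abs_self D
        rw [dist_comm (h x) x] at e₁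
        linarith
      obtain ⟨p, hp, hd⟩ := mem_iUnion₂.1 (hs this)
      exact ⟨p, fun _ => ⟨hp, hd⟩⟩
    · exact ⟨fun _ => x, fun h => absurd h hR⟩
  choose P hP using hcov
  refine Set.Finite.of_injOn (f := P) (t := s) (fun h hh => (hP h hh.2).1) ?_ hsfin
  -- Elements sharing a centre differ by less than `ε / 2` on the net, hence by less than `ε` on
  -- `K`, so `h⁻¹ * h'` lies in the neighbourhood isolating `1`.
  intro h hh h' hh' heq
  have hmem : h⁻¹ * h' ∈ H := H.mul_mem (H.inv_mem hh.1) hh'.1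
  have hone : (⟨h⁻¹ * h', hmem⟩ : H) ∈ ({1} : Set H) := by
    refine hVH (hKV _ fun z hz => ?_)
    obtain ⟨y, hy, hzy⟩ := mem_iUnion₂.1 (ht hz)
    have e₀ : dist z ((h⁻¹ * h') z) = dist (h z) (h' z) := by
      rw [← h.dist_eq z]
      congr 1
      exact h.apply_symm_apply _
    change dist z ((h⁻¹ * h') z) < ε
    rw [e₀]
    have e₁ := dist_triangle4 (h z) (h y) (h' y) (h' z)
    rw [h.dist_eq, h'.dist_eq, dist_comm y z] at e₁
    have e₂ : dist (fun y : t => h y) (fun y : t => h' y) < ε / 4 + ε / 4 := by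
      refine (dist_triangle_right _ _ (P h)).trans_lt (add_lt_add (hP h hh.2).2 ?_)
      rw [heq]
      exact (hP h' hh'.2).2
    have e₃ : dist (h y) (h' y) < ε / 4 + ε / 4 :=
      (dist_le_pi_dist (fun y : t => h y) (fun y : t => h' y) ⟨y, hy⟩).trans_lt e₂
    have e₄ : dist z y < ε / 4 := hzy
    linarith
  have := congrArg Subtype.val (mem_singleton_iff.1 hone)
  exact inv_mul_eq_one.1 this

variable {Γ : Type u} [Group Γ]

/-- The image acts properly, and the fibres of `ρ` are cosets of a finite kernel. -/
theorem finite_setOf_dist_le [ProperSpace X] (ρ : Rep Γ X) (hker : Finite ρ.ker)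
    (hdisc : DiscreteTopology ρ.range) (x : X) (R : ℝ) : {g : Γ | dist x (ρ g x) ≤ R}.Finite := by
  refine ((finite_of_discrete ρ.range x R).preimage' (f := ρ) ?_).subset
    fun g hg => ⟨⟨g, rfl⟩, hg⟩
  rintro _ ⟨⟨g, rfl⟩, -⟩
  refine ((Set.toFinite (ρ.ker : Set Γ)).image (g * ·)).subset fun g' hg' => ?_
  refine ⟨g⁻¹ * g', ?_, by simp⟩
  have : ρ g' = ρ g := hg'
  simp [MonoidHom.mem_ker, this]

/-- A quasi-convex representation has quasi-isometrically embedded orbits. -/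
theorem IsQuasiConvexRep.exists_isQIEmbedding [ProperSpace X] {ρ : Rep Γ X}
    (hρ : IsQuasiConvexRep ρ) (S : FinGenSet Γ) :
    ∃ (x : X) (K C : ℝ), 1 ≤ K ∧ 0 ≤ C ∧ IsQIEmbedding K C (orbitMap S ρ x) := by
  obtain ⟨hker, hdisc, x, η, hη, hqc⟩ := hρ
  obtain ⟨c, hc, hlip⟩ := S.exists_lipschitz (fun g => ρ g x) (ρ.dist_mul_left x)
  -- `2 * η + 1` bounds the distance between orbit points that are `η`-close to consecutive integer
  -- points of a segment.
  obtain ⟨M, hM1, hM⟩ : ∃ M : ℝ, 1 ≤ M ∧ ∀ g : Γ, dist x (ρ g x) ≤ 2 * η + 1 →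
      dist (S.toCayley 1) (S.toCayley g) ≤ M := by
    obtain ⟨M, hM⟩ := ((finite_setOf_dist_le ρ hker hdisc x (2 * η + 1)).image
      fun g => dist (S.toCayley 1) (S.toCayley g)).bddAbove
    exact ⟨max 1 M, le_max_left _ _, fun g hg => (hM ⟨g, hg, rfl⟩).trans (le_max_right _ _)⟩
  have hMdist : ∀ g h : Γ, dist (ρ g x) (ρ h x) ≤ 2 * η + 1 →
      dist (S.toCayley g) (S.toCayley h) ≤ M := fun g h hgh => by
    have e₁ := ρ.dist_mul_left x g 1 (g⁻¹ * h)
    have e₂ := S.dist_toCayley_mul_left g 1 (g⁻¹ * h)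
    rw [mul_one, mul_inv_cancel_left] at e₁ e₂
    rw [e₂]
    refine hM _ ?_
    rw [map_one, IsometryEquiv.coe_one, id] at e₁
    linarith
  have hlow : ∀ g : Γ, dist (S.toCayley 1) (S.toCayley g) ≤ M * (dist x (ρ g x) + 2) := by
    intro g
    obtain ⟨_, ⟨p, hp0, hp1, hp, rfl⟩, hnear⟩ := hqc x ⟨1, ρ.range.one_mem, rfl⟩ (ρ g x)
      ⟨ρ g, ⟨g, rfl⟩, rfl⟩
    set d := dist x (ρ g x) with hd
    have hd0 : 0 ≤ d := dist_nonneg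
    set T := ⌊d⌋₊ with hT
    have hTd : (T : ℝ) ≤ d := Nat.floor_le hd0
    have hTd' : d < T + 1 := Nat.lt_floor_add_one d
    have hsel : ∀ t : ℕ, ∃ a : Γ, t ≤ T → dist (p t) (ρ a x) ≤ η := by
      intro t
      by_cases ht : t ≤ T
      · have ht' : (t : ℝ) ≤ T := by exact_mod_cast ht
        obtain ⟨_, ⟨_, ⟨a, rfl⟩, rfl⟩, ha⟩ :=
          hnear (p t) ⟨t, ⟨t.cast_nonneg, ht'.trans hTd⟩, rfl⟩
        exact ⟨a, fun _ => ha⟩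
      · exact ⟨1, fun h => absurd h ht⟩
    choose a ha using hsel
    -- The extra `M` pays for the jump from `1` to `a 0`; a further one below pays for the jump from
    -- `a T` to `g`.
    have hind : ∀ t : ℕ, t ≤ T → dist (S.toCayley 1) (S.toCayley (a t)) ≤ M * (t + 1) := by
      intro t
      induction t with
      | zero =>
        intro _
        have e := ha 0 (Nat.zero_le _)
        rw [Nat.cast_zero, hp0] at e
        have := hM (a 0) (by linarith)
        simpa using this
      | succ t ih =>
        intro ht
        have e₁ := ih (by omega)
        have ht' : ((t + 1 : ℕ) : ℝ) ≤ T := by exact_mod_cast ht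
        have ht'' : (t : ℝ) ≤ T := by push_cast at ht'; linarith
        have e₂ := hp t ⟨t.cast_nonneg, ht''.trans hTd⟩ (t + 1 : ℕ)
          ⟨Nat.cast_nonneg _, ht'.trans hTd⟩
        push_cast at e₂
        rw [sub_add_cancel_left, abs_neg, abs_one] at e₂
        have e₃ := ha t (by omega)
        have e₄ := ha (t + 1) ht
        push_cast at e₄
        have e₅ := dist_triangle4 (ρ (a t) x) (p t) (p (t + 1)) (ρ (a (t + 1)) x)
        rw [dist_comm (ρ (a t) x) (p t)] at e₅
        have e₆ := hMdist (a t) (a (t + 1)) (by linarith)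
        have e₇ := dist_triangle (S.toCayley 1) (S.toCayley (a t)) (S.toCayley (a (t + 1)))
        push_cast
        linarith
    have e₁ := hind T le_rfl
    have e₂ := ha T le_rfl
    have e₃ := hp T ⟨T.cast_nonneg, hTd⟩ d ⟨hd0, le_rfl⟩
    rw [hp1, abs_sub_comm, abs_of_nonneg (by linarith)] at e₃
    have e₄ := dist_triangle_left (ρ (a T) x) (ρ g x) (p T)
    have e₅ := hMdist (a T) g (by linarith)
    have e₆ := dist_triangle (S.toCayley 1) (S.toCayley (a T)) (S.toCayley g)
    nlinarith
  refine ⟨x, M * c, 2, one_le_mul_of_one_le_of_one_le hM1 hc, zero_le_two, ?_⟩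
  change ∀ g h : Γ, 1 / (M * c) * dist (S.toCayley g) (S.toCayley h) - 2 ≤ dist (ρ g x) (ρ h x) ∧
    dist (ρ g x) (ρ h x) ≤ M * c * dist (S.toCayley g) (S.toCayley h) + 2
  intro g h
  have e₁ := ρ.dist_mul_left x g 1 (g⁻¹ * h)
  have e₂ := S.dist_toCayley_mul_left g 1 (g⁻¹ * h)
  have e₃ := hlow (g⁻¹ * h)
  have e₄ : dist (ρ g x) (ρ h x) ≤ c * dist (S.toCayley g) (S.toCayley h) := hlip g h
  rw [mul_one, mul_inv_cancel_left] at e₁ e₂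
  rw [map_one, IsometryEquiv.coe_one, id] at e₁
  rw [← e₁, ← e₂] at e₃
  have hM0 : 0 < M := by linarith
  have hd : 0 ≤ dist (S.toCayley g) (S.toCayley h) := dist_nonneg
  constructor
  · have f₁ : 1 / (M * c) * dist (S.toCayley g) (S.toCayley h) ≤
        1 / M * dist (S.toCayley g) (S.toCayley h) := by
      gcongr
      exact le_mul_of_one_le_right hM0.le hc
    have f₂ : 1 / M * dist (S.toCayley g) (S.toCayley h) ≤ dist (ρ g x) (ρ h x) + 2 := by
      rw [one_div, inv_mul_le_iff₀ hM0]
      exact e₃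
    linarith
  · have f₁ : c * dist (S.toCayley g) (S.toCayley h) ≤
        M * c * dist (S.toCayley g) (S.toCayley h) := by
      gcongr
      exact le_mul_of_one_le_left (by linarith) hM1
    linarith

theorem IsQuasiConvexRep.isStable [ProperSpace X] {ρ : Rep Γ X} (hρ : IsQuasiConvexRep ρ)
    (S : FinGenSet Γ) (A : Set Γ) : IsStable S A ρ := by
  obtain ⟨x, K, C, hK, hC, h⟩ := hρ.exists_isQIEmbedding S
  refine ⟨K, C, hK, hC, x, fun l _ m n => ?_⟩
  have := h (l.1 m) (l.1 n)
  rwa [l.2.dist_eq] at this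

end QuasiConvex

/-! ### Openness of stability. -/

section Openness

variable {Γ : Type u} [Group Γ] {X : Type v} [MetricSpace X]

/-- The topology controls only the generators. Continuity of evaluations extends to products and
inverses because each `ρ g` is an isometry, so errors are not amplified. -/
theorem continuous_rep_apply (S : FinGenSet Γ) (g : Γ) :
    ∀ y : X, Continuous[repTopology X S, inferInstance] (fun ρ : Rep Γ X => ρ g y) := by
  let _ : TopologicalSpace (Rep Γ X) := repTopology X S
  have hg : g ∈ Subgroup.closure (S.gens : Set Γ) := by rw [S.closure_gens]; trivial
  induction hg using Subgroup.closure_induction with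
  | mem s hs =>
    intro y
    have h₁ : Continuous fun ρ : Rep Γ X => fun s : S.gens => ρ (s : Γ) := continuous_induced_dom
    have h₂ : Continuous fun g : X ≃ᵢ X => (⟨g, g.continuous⟩ : C(X, X)) := continuous_induced_dom
    exact ((continuous_eval_const y).comp h₂).comp
      ((continuous_apply (⟨s, hs⟩ : S.gens)).comp h₁)
  | one => intro y; simpa using continuous_const
  | mul g h _ _ hg hh =>
    intro y
    refine continuous_iff_continuousAt.2 fun ρ₀ => ?_
    refine tendsto_iff_dist_tendsto_zero.2 ?_
    have l₁ := tendsto_iff_dist_tendsto_zero.1 ((hh y).tendsto ρ₀)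
    have l₂ := tendsto_iff_dist_tendsto_zero.1 ((hg (ρ₀ h y)).tendsto ρ₀)
    have l₃ := l₁.add l₂
    rw [add_zero] at l₃
    refine squeeze_zero (fun _ => dist_nonneg) (fun ρ => ?_) l₃
    simp only [map_mul]
    refine (dist_triangle _ (ρ g (ρ₀ h y)) _).trans_eq ?_
    congr 1
    exact (ρ g).dist_eq _ _
  | inv g _ hg =>
    intro y
    refine continuous_iff_continuousAt.2 fun ρ₀ => ?_
    refine tendsto_iff_dist_tendsto_zero.2 ?_
    have l := tendsto_iff_dist_tendsto_zero.1 ((hg (ρ₀ g⁻¹ y)).tendsto ρ₀)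
    refine l.congr fun ρ => ?_
    rw [dist_comm, ← (ρ g).dist_eq (ρ g⁻¹ y)]
    congr 1
    simp only [map_inv]
    exact ((ρ₀ g).apply_symm_apply y).trans ((ρ g).apply_symm_apply y).symm

/-- A conjugation-invariant set is saturated, so its openness passes to the quotient. -/
theorem Rep.cls_mem_image_cls_iff {W : Set (Rep Γ X)}
    (hW : ∀ ρ ∈ W, ∀ g : X ≃ᵢ X, (MulAut.conj g).toMonoidHom.comp ρ ∈ W) (ρ : Rep Γ X) :
    ρ.cls ∈ Rep.cls '' W ↔ ρ ∈ W := by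
  refine ⟨?_, fun h => ⟨ρ, h, rfl⟩⟩
  rintro ⟨σ, hσ, h⟩
  obtain ⟨g, rfl⟩ := (Rep.cls_eq_iff _ _).1 h
  exact hW σ hσ g

theorem Rep.isOpen_image_cls (S : FinGenSet Γ) {W : Set (Rep Γ X)}
    (hW : ∀ ρ ∈ W, ∀ g : X ≃ᵢ X, (MulAut.conj g).toMonoidHom.comp ρ ∈ W)
    (hopen : IsOpen[repTopology X S] W) : IsOpen[classTopology X S] (Rep.cls '' W) := by
  let _ : TopologicalSpace (Rep Γ X) := repTopology X S
  refine isOpen_coinduced.2 ?_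
  convert hopen using 1
  ext ρ
  exact Rep.cls_mem_image_cls_iff hW ρ

/-- Conjugating by `g` amounts to moving the base point by `g`; hence displacement conditions at
some unspecified base point are conjugation-invariant. -/
theorem Rep.dist_conj (ρ : Rep Γ X) (g : X ≃ᵢ X) (a b : Γ) (y : X) :
    dist ((MulAut.conj g).toMonoidHom.comp ρ a (g y)) ((MulAut.conj g).toMonoidHom.comp ρ b (g y)) =
      dist (ρ a y) (ρ b y) := by
  have h : ∀ c, (MulAut.conj g).toMonoidHom.comp ρ c (g y) = g (ρ c y) := fun c => by
    change (g * ρ c * g⁻¹) (g y) = _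
    exact congrArg (fun z => g (ρ c z)) (g.symm_apply_apply y)
  rw [h, h, g.dist_eq]

/-- Representations which displace some point by almost the same amounts as `ρ₀` displaces `x`. -/
theorem exists_open_displacement (S : FinGenSet Γ) (ρ₀ : Rep Γ X) (x : X) (r : ℝ) :
    ∃ U : Set (RepClass Γ X), IsOpen[classTopology X S] U ∧ ρ₀.cls ∈ U ∧
      ∀ ρ : Rep Γ X, ρ.cls ∈ U → ∃ y : X, ∀ g : Γ, dist (S.toCayley 1) (S.toCayley g) ≤ r →
        |dist y (ρ g y) - dist x (ρ₀ g x)| < 1 := by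
  set W : Set (Rep Γ X) := {ρ | ∃ y : X, ∀ g : Γ, dist (S.toCayley 1) (S.toCayley g) ≤ r →
    |dist y (ρ g y) - dist x (ρ₀ g x)| < 1} with hWdef
  have hW : ∀ ρ ∈ W, ∀ g : X ≃ᵢ X, (MulAut.conj g).toMonoidHom.comp ρ ∈ W := by
    rintro ρ ⟨y, hy⟩ g
    refine ⟨g y, fun a ha => ?_⟩
    have e := Rep.dist_conj ρ g 1 a y
    simp only [map_one, IsometryEquiv.coe_one, id] at e
    rw [e]
    exact hy a ha
  have hopen : IsOpen[repTopology X S] W := by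
    let _ : TopologicalSpace (Rep Γ X) := repTopology X S
    have e : W = ⋃ y : X, ⋂ g ∈ {g : Γ | dist (S.toCayley 1) (S.toCayley g) ≤ r},
        {ρ : Rep Γ X | |dist y (ρ g y) - dist x (ρ₀ g x)| < 1} := by
      ext ρ
      simp [hWdef]
    rw [e]
    refine isOpen_iUnion fun y => (S.finite_ball 1 r).isOpen_biInter fun g _ => ?_
    have hc : Continuous fun ρ : Rep Γ X => ρ g y := continuous_rep_apply S g y
    exact isOpen_lt ((continuous_const.dist hc).sub continuous_const).abs continuous_const
  refine ⟨Rep.cls '' W, Rep.isOpen_image_cls S hW hopen, ⟨ρ₀, ⟨x, fun g _ => by simp⟩, rfl⟩,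
    fun ρ hρ => (Rep.cls_mem_image_cls_iff hW ρ).1 hρ⟩

/-- Stability is an open condition, with uniform constants. -/
theorem exists_open_isStableWith (δ K₀ C₀ : ℝ) (hδ : 0 < δ) (hK₀ : 1 ≤ K₀) (hC₀ : 0 ≤ C₀) :
    ∃ K C : ℝ, 1 ≤ K ∧ 0 ≤ C ∧ ∀ (Γ : Type u) [Group Γ] (S : FinGenSet Γ) (X : Type v)
      [MetricSpace X] (A : Set Γ), IsGeodesicSpace X → IsHyperbolicityConstant X δ →
        ∀ ρ₀ : Rep Γ X, IsStableWith S A K₀ C₀ ρ₀ →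
          ∃ U : Set (RepClass Γ X), IsOpen[classTopology X S] U ∧ ρ₀.cls ∈ U ∧
            ∀ ρ : Rep Γ X, ρ.cls ∈ U → IsStableWith S A K C ρ := by
  -- The `1` added to `C₀` is the tolerance of `exists_open_displacement`. `L`, `K` and `C` are
  -- fixed before `Γ`, `S` and `X` appear.
  obtain ⟨L, K, C, hK, hC, hglobal⟩ :=
    exists_local_to_global.{v} δ K₀ (C₀ + 1) hδ hK₀ (by linarith)
  refine ⟨K, C, hK, hC, fun Γ _ S X _ A hgeo hhyp ρ₀ ⟨x, hx⟩ => ?_⟩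
  obtain ⟨U, hU, hρ₀, hdisp⟩ := exists_open_displacement S ρ₀ x L
  refine ⟨U, hU, hρ₀, fun ρ hρ => ?_⟩
  obtain ⟨y, hy⟩ := hdisp ρ hρ
  refine ⟨y, fun l hl => hglobal X hhyp hgeo.isRoughlyGeodesic _ fun m n hn => ?_⟩
  have h₀ := hx l hl m (m + n)
  have hdist : dist (l.1 m) (l.1 (m + n)) = n := by
    rw [l.2.dist_eq, Int.dist_eq]
    push_cast
    rw [sub_add_cancel_left, abs_neg, Nat.abs_cast]
  rw [← l.2.dist_eq, hdist] at h₀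
  simp only [orbitMap] at h₀ ⊢
  set g : Γ := l.1 m with hg
  set h : Γ := l.1 (m + n) with hh
  -- Every window of every line thus reduces to an element `g⁻¹ * h` of the ball of radius `L`.
  have e₁ : ∀ (σ : Rep Γ X) (z : X), dist (σ g z) (σ h z) = dist z (σ (g⁻¹ * h) z) := fun σ z => by
    have := σ.dist_mul_left z g 1 (g⁻¹ * h)
    rwa [mul_one, mul_inv_cancel_left, map_one, IsometryEquiv.coe_one, id] at this
  have e₂ : dist (S.toCayley 1) (S.toCayley (g⁻¹ * h)) ≤ L := by
    have := S.dist_toCayley_mul_left g 1 (g⁻¹ * h)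
    rw [mul_one, mul_inv_cancel_left] at this
    rw [← this]
    exact hdist.trans_le (by exact_mod_cast hn)
  have e₃ := abs_lt.1 (hy _ e₂)
  rw [e₁] at h₀ ⊢
  constructor <;> linarith [e₃.1, e₃.2, h₀.1, h₀.2]

end Openness

end AStable

end

theorem proposition1p1 :
    (∀ (Γ : Type u) [Group Γ] (S : AStable.FinGenSet Γ) (X : Type v) [MetricSpace X]
      [ProperSpace X] (A : Set Γ),
      AStable.IsHyperbolicGroup Γ → AStable.IsGeodesicSpace X → AStable.IsGromovHyperbolic X →
      AStable.IsAutInvariant A →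
        IsOpen[AStable.classTopology X S] (AStable.stableSet X S A) ∧
        (∀ (o : AStable.Out Γ) (p : AStable.RepClass Γ X),
          o • p ∈ AStable.stableSet X S A ↔ p ∈ AStable.stableSet X S A) ∧
        AStable.QC Γ X ⊆ AStable.stableSet X S A) ∧
    (∀ δ K₀ C₀ : ℝ, 0 < δ → 1 ≤ K₀ → 0 ≤ C₀ → ∃ K C : ℝ, 1 ≤ K ∧ 0 ≤ C ∧
      ∀ (Γ : Type u) [Group Γ] (S : AStable.FinGenSet Γ) (X : Type v) [MetricSpace X]
        [ProperSpace X] (A : Set Γ),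
        AStable.IsHyperbolicGroup Γ → AStable.IsGeodesicSpace X →
        AStable.IsHyperbolicityConstant X δ → AStable.IsAutInvariant A →
        ∀ ρ₀ : AStable.Rep Γ X, AStable.IsStableWith S A K₀ C₀ ρ₀ →
          ∃ U : Set (AStable.RepClass Γ X), IsOpen[AStable.classTopology X S] U ∧ ρ₀.cls ∈ U ∧
            ∀ ρ : AStable.Rep Γ X, ρ.cls ∈ U → AStable.IsStableWith S A K C ρ) := by
  refine ⟨fun Γ _ S X _ _ A hΓ hgeo ⟨δ, hδ⟩ hA => ⟨?_, ?_, ?_⟩, fun δ K₀ C₀ hδ hK₀ hC₀ => ?_⟩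
  · let _ := AStable.classTopology (Γ := Γ) X S
    refine isOpen_iff_forall_mem_open.2 ?_
    rintro _ ⟨ρ₀, ⟨K₀, C₀, hK₀, hC₀, hρ₀⟩, rfl⟩
    obtain ⟨K, C, hK, hC, h⟩ := AStable.exists_open_isStableWith.{u, v} δ K₀ C₀ hδ.1 hK₀ hC₀
    obtain ⟨U, hU, hmem, hstable⟩ := h Γ S X A hgeo hδ ρ₀ hρ₀
    refine ⟨U, fun p hp => ?_, hU, hmem⟩
    obtain ⟨ρ, rfl⟩ := Quotient.exists_rep p
    exact ⟨ρ, ⟨K, C, hK, hC, hstable ρ hp⟩, rfl⟩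
  · have key : ∀ (o : AStable.Out Γ) (p : AStable.RepClass Γ X),
        p ∈ AStable.stableSet X S A → o • p ∈ AStable.stableSet X S A := by
      rintro o _ ⟨ρ, hρ, rfl⟩
      obtain ⟨φ, rfl⟩ := QuotientGroup.mk_surjective o
      exact ⟨ρ.comp (φ⁻¹).toMonoidHom, hρ.comp_mulAut hΓ hA φ⁻¹, rfl⟩
    exact fun o p => ⟨fun h => by simpa using key o⁻¹ _ h, key o p⟩
  · rintro _ ⟨ρ, hρ, rfl⟩
    exact ⟨ρ, AStable.IsQuasiConvexRep.isStable hρ S A, rfl⟩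
  · obtain ⟨K, C, hK, hC, h⟩ := AStable.exists_open_isStableWith.{u, v} δ K₀ C₀ hδ hK₀ hC₀
    exact ⟨K, C, hK, hC, fun Γ _ S X _ _ A _ hgeo hhyp _ => h Γ S X A hgeo hhyp⟩
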